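/- Let $S^1=\mathbb R/\mathbb Z$ and let $f:S^1\to S^1$ be a multicritical circle map, that is: an orientation-preserving homeomorphism of class $C^3$ with finitely many critical points (zeros of $f'$), such that each critical point $c_i$ has a neighbourhood $W_i$ with the following properties: (1) $Sf=\left(f''/f'\right)'-\frac12\left(f''/f'\right)^2<0$ on $W_i\setminus\{c_i\}$; (2) there are constants $0<\alpha_i<\beta_i$ and $s_i>1$ with $\alpha_i|x-c_i|^{s_i-1}<f'(x)<\beta_i|x-c_i|^{s_i-1}$ for all $x\in W_i\setminus\{c_i\}$; (3) $\log f'$ has bounded variation on $S^1\setminus\bigcup_i W_i$. Assume that $f$ has no periodic points, so that its rotation number $\rho\in(0,1)$ is irrational, and let $\rho=\cfrac{1}{a_0+\cfrac{1}{a_1+\cdots}}$ be its continued fraction expansion. Put $q_0=1$, $q_1=a_0$, $q_{n+1}=a_nq_n+q_{n-1}$ for $n\ge 1$. For $x\in S^1$ and $n\ge 0$ let $I_n(x)$ be the closed interval in $S^1$ with endpoints $x$ and $f^{q_n}(x)$ that contains $f^{q_{n+2}}(x)$, and let $$\mathcal P_n(x)=\{f^i(I_n(x)):0\le i\le q_{n+1}-1\}\cup\{f^j(I_{n+1}(x)):0\le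 j\le q_n-1\}$$ be the $n$-th dynamical partition associated with $x$; its elements are called atoms. Then there is a constant $K>1$, depending only on $f$, such that for all $n\ge 0$, all critical points $c,c'$ of $f$, and all atoms $\Delta\in\mathcal P_n(c)$ and $\Delta'\in\mathcal P_n(c')$ with $\Delta\cap\Delta'\neq\varnothing$, the lengths of $\Delta$ and $\Delta'$ are comparable: $$K^{-1}|\Delta'|\le|\Delta|\le K|\Delta'|.$$ -/

import Mathlib

noncomputable section

namespace CircleDynamics

open Set Function Topology MeasureTheory

/-- `F : ℝ → ℝ` (monotone, with `F (x + 1) = F x + 1`) is a continuous lift to the universal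
cover of the circle map `f : ℝ/ℤ → ℝ/ℤ`. -/
def IsLift (F : CircleDeg1Lift) (f : UnitAddCircle → UnitAddCircle) : Prop :=
  Continuous F ∧ ∀ x : ℝ, ((F x : ℝ) : UnitAddCircle) = f (x : UnitAddCircle)

/-- A homeomorphism of the circle preserves orientation iff it has a monotone degree one lift. -/
def IsOrientationPreserving (f : UnitAddCircle ≃ₜ UnitAddCircle) : Prop :=
  ∃ F : CircleDeg1Lift, IsLift F f

/-- Two lifts of the same circle map differ by an integer translation. -/
theorem IsLift.eq_add_int {F G : CircleDeg1Lift} {f : UnitAddCircle → UnitAddCircle}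
    (hF : IsLift F f) (hG : IsLift G f) : ∃ m : ℤ, ∀ x, G x = F x + m := by
  have h1 : ∀ x, ∃ m : ℤ, (m : ℝ) = G x - F x := by
    intro x
    have h : ((G x : ℝ) : UnitAddCircle) = ((F x : ℝ) : UnitAddCircle) := by
      rw [hF.2, hG.2]
    have h2 : ((G x - F x : ℝ) : UnitAddCircle) = 0 := by
      rw [AddCircle.coe_sub, h, sub_self]
    obtain ⟨m, hm⟩ := (AddCircle.coe_eq_zero_iff (1 : ℝ)).1 h2
    exact ⟨m, by simpa using hm⟩
  choose m hm using h1
  have hc : Continuous m := by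
    refine Int.isClosedEmbedding_coe_real.isEmbedding.continuous_iff.2 ?_
    have : ((fun n : ℤ => (n : ℝ)) ∘ m) = fun x => G x - F x := funext hm
    rw [this]
    exact hG.1.sub hF.1
  refine ⟨m 0, fun x => ?_⟩
  have h := (PreconnectedSpace.constant (Y := ℤ) inferInstance hc : m x = m 0)
  have h2 := hm x
  rw [h] at h2
  linarith

open Classical in
/-- A lift of an orientation preserving circle homeomorphism, unique up to adding an integer
(the value is irrelevant if `f` reverses the orientation). -/
def lift (f : UnitAddCircle ≃ₜ UnitAddCircle) : CircleDeg1Lift :=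
  if h : IsOrientationPreserving f then h.choose else 1

/-- The rotation number, normalised to lie in `[0, 1)`. -/
def rotationNumber (f : UnitAddCircle ≃ₜ UnitAddCircle) : ℝ :=
  Int.fract (lift f).translationNumber

theorem isLift_lift {f : UnitAddCircle ≃ₜ UnitAddCircle} (h : IsOrientationPreserving f) :
    IsLift (lift f) f := by
  unfold lift
  rw [dif_pos h]
  exact h.choose_spec

/-- The rotation number does not depend on the lift. -/
theorem IsLift.rotationNumber_eq {f : UnitAddCircle ≃ₜ UnitAddCircle} {F : CircleDeg1Lift}
    (hF : IsLift F f) : rotationNumber f = Int.fract F.translationNumber := by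
  obtain ⟨m, hm⟩ := hF.eq_add_int (isLift_lift ⟨F, hF⟩)
  have h : lift f = (CircleDeg1Lift.translate (Multiplicative.ofAdd (m : ℝ)) : CircleDeg1Lift) * F := by
    ext x
    simp [hm, add_comm]
  have h2 : (lift f).translationNumber = m + F.translationNumber := by
    rw [h, CircleDeg1Lift.translationNumber_mul_of_commute, CircleDeg1Lift.translationNumber_translate]
    rw [CircleDeg1Lift.commute_iff_commute]
    intro x
    simp [add_comm]
  rw [rotationNumber, h2, Int.fract_intCast_add]

/-- The derivative of `f`, as a function on the universal cover: it is `1`-periodic and does not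
depend on the choice of the lift. -/
def Df (f : UnitAddCircle ≃ₜ UnitAddCircle) (x : ℝ) : ℝ := deriv (lift f) x

/-- The Schwarzian derivative `(F''/F')' - (F''/F')² / 2`. -/
def schwarzian (F : ℝ → ℝ) (x : ℝ) : ℝ :=
  deriv (fun y => deriv (deriv F) y / deriv F y) x
    - (1 / 2) * (deriv (deriv F) x / deriv F x) ^ 2

/-- The critical points of `f` on the circle. -/
def criticalPoints (f : UnitAddCircle ≃ₜ UnitAddCircle) : Set UnitAddCircle :=
  {c | ∃ x : ℝ, (x : UnitAddCircle) = c ∧ Df f x = 0}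

/-- Multicritical circle maps: orientation preserving `C³` homeomorphisms with finitely many
critical points, all non-flat of power-law type, with negative Schwarzian derivative near each
critical point and `log Df` of bounded variation away from them. Here `‖x - c‖` is the distance
on the circle `ℝ/ℤ`. -/
structure IsMulticritical (f : UnitAddCircle ≃ₜ UnitAddCircle) : Prop where
  orientationPreserving : IsOrientationPreserving f
  contDiff : ContDiff ℝ 3 (lift f)
  finite : (criticalPoints f).Finite
  nonflat : ∃ W : UnitAddCircle → Set UnitAddCircle,
    (∀ c ∈ criticalPoints f, W c ∈ 𝓝 c ∧
      (∀ x : ℝ, (x : UnitAddCircle) ∈ W c → (x : UnitAddCircle) ≠ c →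
        schwarzian (lift f) x < 0) ∧
      ∃ α β s : ℝ, 0 < α ∧ α < β ∧ 1 < s ∧
        ∀ x : ℝ, (x : UnitAddCircle) ∈ W c → (x : UnitAddCircle) ≠ c →
          α * ‖(x : UnitAddCircle) - c‖ ^ (s - 1) < Df f x ∧
          Df f x < β * ‖(x : UnitAddCircle) - c‖ ^ (s - 1)) ∧
    BoundedVariationOn (fun x : ℝ => Real.log (Df f x))
      {x : ℝ | x ∈ Icc 0 1 ∧ ∀ c ∈ criticalPoints f, (x : UnitAddCircle) ∉ W c}

/-- The partial quotients `a₀, a₁, …` of `ρ = 1/(a₀ + 1/(a₁ + ⋯)) ∈ (0, 1)`: the partial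
denominators of Mathlib's continued fraction of `ρ`, which are natural numbers
(set to `0` after a termination, which happens for rational `ρ` only). -/
def partialQuotient (ρ : ℝ) (n : ℕ) : ℕ :=
  ((GenContFract.of ρ).partDens.get? n).elim 0 Nat.floor

/-- The sequence `q₀ = 1`, `q₁ = a₀`, `qₙ₊₁ = aₙ qₙ + qₙ₋₁`. -/
def returnTime (ρ : ℝ) : ℕ → ℕ
  | 0 => 1
  | 1 => partialQuotient ρ 0
  | n + 2 => partialQuotient ρ (n + 1) * returnTime ρ (n + 1) + returnTime ρ n

/-- The return times `qₙ` of `f`. -/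
def q (f : UnitAddCircle ≃ₜ UnitAddCircle) (n : ℕ) : ℕ := returnTime (rotationNumber f) n

open Classical in
/-- `Iₙ(x)`: of the two closed arcs with endpoints `x` and `f^{qₙ}(x)`, the one which contains
`f^{qₙ₊₂}(x)`. (`cIcc a b` is the closed arc going counterclockwise from `a` to `b`.) -/
def closestReturnArc (f : UnitAddCircle ≃ₜ UnitAddCircle) (n : ℕ) (x : UnitAddCircle) :
    Set UnitAddCircle :=
  if f^[q f (n + 2)] x ∈ cIcc x (f^[q f n] x) then cIcc x (f^[q f n] x)
  else cIcc (f^[q f n] x) x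

/-- The `n`-th dynamical partition associated to `x`, as its set of atoms. -/
def dynamicalPartition (f : UnitAddCircle ≃ₜ UnitAddCircle) (n : ℕ) (x : UnitAddCircle) :
    Set (Set UnitAddCircle) :=
  {Δ | ∃ i < q f (n + 1), Δ = f^[i] '' closestReturnArc f n x} ∪
    {Δ | ∃ j < q f n, Δ = f^[j] '' closestReturnArc f (n + 1) x}

/-- The length of an arc (the circle `ℝ/ℤ` has length one). -/
def length (Δ : Set UnitAddCircle) : ℝ := (volume Δ).toReal

end CircleDynamics

end

/-! Work on the line. Let G and H be the lifts of the returns `f^{q_n}` and `f^{q_{n+1}}`,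
normalised by integer translations; they move points in opposite directions, and H lies between the
identity and the inverse of G. Atoms are projections of long arcs between x and Gx and of short arcs
between x and Hx. Two bounds with constants independent of n suffice. First, adjacent long arcs are
comparable at every point of the line (`HasDistortionBounds.adjacent_le`). Second, at y = f^j(c)
with c critical and 0 ≤ j ≤ q_{n+1}, the long arc is at most a constant times the short arc
(`HasDistortionBounds.exists_gap_le`). Given these, a long arc meeting another lies in the union of
three consecutive copies of that other, and a short arc at y lies in the long arc on the same side
of y; so atoms that meet are comparable.

The tool is the cross-ratio (b-a)(d-c)/((c-a)(d-b)), which iterates cannot increase much. A single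
step costs at most a factor B. If the quadruple is short and spans no critical point, the step costs
only exp(Λ(d-a)): near a critical point negative Schwarzian derivative forbids any increase, and
elsewhere F' is bounded below. Along q_{n+1} iterates of three adjacent long arcs the total length
is at most 3 and each critical point is met at most four times, so the product of all the factors is
bounded (`HasDistortionBounds.crossRatio_act_le`).

For the first bound, start where the long arc is shortest: its cross-ratio with its neighbours is
bounded below. Every orbit comes near that place within q_n + q_{n+1} steps, and lower bounds pull
back along the orbit. For the second, if H moved a critical point c by much less than G does,
flatness at c would make the first iterate of a short interval to the left of c tiny; the remaining
iterates would keep it small, and H would push its left end to the right, which it never does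
(`HasDistortionBounds.mul_le_return_of_flat`). The case where G moves points to the left is reduced
to this one by conjugating with x ↦ -x. -/

noncomputable section

namespace CircleDynamics

open Set Function Topology MeasureTheory

/-! ### Cross-ratios and the Schwarzian derivative -/

/-- The cross-ratio of a quadruple of points. -/
def crossRatio (a b c d : ℝ) : ℝ := (b - a) * (d - c) / ((c - a) * (d - b))

theorem crossRatio_pos {a b c d : ℝ} (h1 : a < b) (h2 : b < c) (h3 : c < d) :
    0 < crossRatio a b c d := by
  have := h1.trans h2
  have := h2.trans h3
  unfold crossRatio
  have h4 : 0 < c - a := by linarith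
  have h5 : 0 < d - b := by linarith
  have h6 : 0 < b - a := by linarith
  have h7 : 0 < d - c := by linarith
  positivity

/-- The function h = (F')^{-1/2} satisfies h'' = -(1/2) (SF) h. -/
theorem convexOn_of_schwarzian_neg {F : ℝ → ℝ} (hF : ContDiff ℝ 3 F) {l r : ℝ}
    (hpos : ∀ x ∈ Ioo l r, 0 < deriv F x) (hS : ∀ x ∈ Ioo l r, schwarzian F x < 0) :
    ConvexOn ℝ (Ioo l r) (fun x => (√(deriv F x))⁻¹) := by
  have h1 : ContDiff ℝ 2 (deriv F) := by
    have := (contDiff_succ_iff_deriv (n := 2) (f := F) (𝕜 := ℝ)).1 (by exact_mod_cast hF)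
    exact this.2.2
  have h2 : ContDiff ℝ 1 (deriv (deriv F)) := by
    have := (contDiff_succ_iff_deriv (n := 1) (f := deriv F) (𝕜 := ℝ)).1 (by exact_mod_cast h1)
    exact this.2.2
  set g : ℝ → ℝ := fun y => deriv (deriv F) y / deriv F y with hg
  have d1 : Differentiable ℝ (deriv F) := h1.differentiable (by norm_num)
  have d2 : Differentiable ℝ (deriv (deriv F)) := h2.differentiable (by norm_num)
  have hgd : ∀ x ∈ Ioo l r, HasDerivAt g (deriv g x) x := fun x hx =>
    ((d2 x).div (d1 x) (hpos x hx).ne').hasDerivAt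
  have hh : ∀ x ∈ Ioo l r, HasDerivAt (fun x => (√(deriv F x))⁻¹)
      (-(1 / 2) * (g x * (√(deriv F x))⁻¹)) x := by
    intro x hx
    have hp := hpos x hx
    have hs : 0 < √(deriv F x) := Real.sqrt_pos.2 hp
    have := ((d1 x).hasDerivAt.sqrt hp.ne').inv hs.ne'
    refine this.congr_deriv ?_
    have e : √(deriv F x) ^ 2 = deriv F x := Real.sq_sqrt hp.le
    simp only [hg]
    rw [e]
    field_simp
  have hh2 : ∀ x ∈ Ioo l r, HasDerivAt (fun x => -(1 / 2) * (g x * (√(deriv F x))⁻¹))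
      (-(1 / 2) * (schwarzian F x * (√(deriv F x))⁻¹)) x := by
    intro x hx
    refine (((hgd x hx).mul (hh x hx)).const_mul (-(1 / 2))).congr_deriv ?_
    have : schwarzian F x = deriv g x - (1 / 2) * (g x) ^ 2 := rfl
    rw [this]
    ring
  refine convexOn_of_hasDerivWithinAt2_nonneg (convex_Ioo l r) ?_
    (f' := fun x => -(1 / 2) * (g x * (√(deriv F x))⁻¹))
    (f'' := fun x => -(1 / 2) * (schwarzian F x * (√(deriv F x))⁻¹)) ?_ ?_ ?_
  · exact fun x hx => (hh x hx).continuousAt.continuousWithinAt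
  · rw [interior_Ioo]; exact fun x hx => (hh x hx).hasDerivWithinAt
  · rw [interior_Ioo]; exact fun x hx => (hh2 x hx).hasDerivWithinAt
  · rw [interior_Ioo]
    intro x hx
    have hs : 0 < (√(deriv F x))⁻¹ := inv_pos.2 (Real.sqrt_pos.2 (hpos x hx))
    nlinarith [hS x hx]

/-- A convex h = (F')^{-1/2} lies below its chord ℓ on [x, y], so F' ≥ ℓ^{-2}; the integral of
ℓ^{-2} over [x, y] is exactly (y-x)/(h(x)h(y)). This is the infinitesimal form of the cross-ratio
inequality. -/
theorem deriv_mul_deriv_le_of_convexOn {F : ℝ → ℝ} (hF : Differentiable ℝ F) {l r : ℝ}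
    (hpos : ∀ x ∈ Ioo l r, 0 < deriv F x)
    (hc : ConvexOn ℝ (Ioo l r) (fun x => (√(deriv F x))⁻¹)) {x y : ℝ} (hx : x ∈ Ioo l r)
    (hy : y ∈ Ioo l r) (hxy : x < y) :
    deriv F x * deriv F y * (y - x) ^ 2 ≤ (F y - F x) ^ 2 := by
  set h : ℝ → ℝ := fun x => (√(deriv F x))⁻¹ with hh
  have hp : ∀ t ∈ Ioo l r, 0 < h t := fun t ht => inv_pos.2 (Real.sqrt_pos.2 (hpos t ht))
  have hsq : ∀ t ∈ Ioo l r, (h t ^ 2)⁻¹ = deriv F t := fun t ht => by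
    simp only [hh, inv_pow, inv_inv, Real.sq_sqrt (hpos t ht).le]
  have hsub : Icc x y ⊆ Ioo l r := fun t ht => ⟨hx.1.trans_le ht.1, ht.2.trans_lt hy.2⟩
  have hd : 0 < y - x := sub_pos.2 hxy
  set k := (h y - h x) / (y - x) with hk
  set ℓ : ℝ → ℝ := fun t => h x + k * (t - x) with hℓ
  have hle : ∀ t ∈ Icc x y, h t ≤ ℓ t := by
    intro t ht
    have e : t = ((y - t) / (y - x)) • x + ((t - x) / (y - x)) • y := by
      simp only [smul_eq_mul]; field_simp; ring
    have := hc.2 hx hy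
      (div_nonneg (sub_nonneg.2 ht.2) hd.le) (div_nonneg (sub_nonneg.2 ht.1) hd.le)
      (by field_simp; ring)
    rw [← e] at this
    refine this.trans (le_of_eq ?_)
    simp only [smul_eq_mul, hℓ, hk]
    change (y - t) / (y - x) * h x + (t - x) / (y - x) * h y = _
    field_simp
    ring
  have hℓp : ∀ t ∈ Icc x y, 0 < ℓ t := fun t ht => (hp t (hsub ht)).trans_le (hle t ht)
  -- The subtracted term is the primitive of ℓ^{-2} vanishing at x, so monotonicity replaces
  -- integration.
  have hΦ : ∀ t ∈ Icc x y, HasDerivAt (fun t => F t - (t - x) / ℓ t / h x)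
      (deriv F t - (ℓ t ^ 2)⁻¹) t := by
    intro t ht
    have h1 : HasDerivAt ℓ k t := by
      have := (((hasDerivAt_id t).sub_const x).const_mul k).const_add (h x)
      rwa [mul_one] at this
    have h2 := ((((hasDerivAt_id t).sub_const x).div h1 (hℓp t ht).ne').div_const (h x))
    refine ((hF t).hasDerivAt.sub h2).congr_deriv ?_
    have := (hp x hx).ne'
    have := (hℓp t ht).ne'
    simp only [id]
    congr 1
    have e : 1 * ℓ t - (t - x) * k = h x := by simp only [hℓ]; ring
    rw [e]
    field_simp
  have hmono : MonotoneOn (fun t => F t - (t - x) / ℓ t / h x) (Icc x y) := by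
    refine monotoneOn_of_deriv_nonneg (convex_Icc x y)
      (fun t ht => (hΦ t ht).continuousAt.continuousWithinAt)
      (fun t ht => (hΦ t (interior_subset ht)).differentiableAt.differentiableWithinAt) ?_
    intro t ht
    have ht := interior_subset ht
    rw [(hΦ t ht).deriv, ← hsq t (hsub ht), sub_nonneg]
    have := hp t (hsub ht)
    have := hle t ht
    gcongr
  have h3 := hmono (left_mem_Icc.2 hxy.le) (right_mem_Icc.2 hxy.le) hxy.le
  have e1 : ℓ y = h y := by simp only [hℓ, hk]; field_simp; ring
  simp only [sub_self, zero_div, sub_zero, e1] at h3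
  have h4 : (y - x) / h y / h x ≤ F y - F x := by linarith
  have h5 : 0 ≤ (y - x) / h y / h x := by
    have := hp x hx
    have := hp y hy
    positivity
  have h6 := pow_le_pow_left₀ h5 h4 2
  refine le_trans (le_of_eq ?_) h6
  rw [← hsq x hx, ← hsq y hy]
  have := hp x hx
  have := hp y hy
  field_simp

/-- The infinitesimal inequality says that F'(x)F'(y)/(F(y)-F(x))² ≤ 1/(y-x)². It is integrated over
y in [c, d], and then over x in [a, b], each time through the sign of a derivative. -/
theorem crossRatio_le_of_convexOn {F : ℝ → ℝ} (hF : Differentiable ℝ F) {l r : ℝ}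
    (hpos : ∀ x ∈ Ioo l r, 0 < deriv F x)
    (hc : ConvexOn ℝ (Ioo l r) (fun x => (√(deriv F x))⁻¹)) (hm : StrictMono F)
    {a b c d : ℝ} (hla : l < a) (hab : a < b) (hbc : b < c) (hcd : c < d) (hdr : d < r) :
    crossRatio (F a) (F b) (F c) (F d) ≤ crossRatio a b c d := by
  have key : ∀ x ∈ Icc a b, deriv F x / (F c - F x) - 1 / (c - x) ≤
      deriv F x / (F d - F x) - 1 / (d - x) := by
    intro x hx
    have hxl : x ∈ Ioo l r := ⟨by linarith [hx.1], by linarith [hx.2]⟩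
    have hD : ∀ y ∈ Icc c d, HasDerivAt (fun y => deriv F x / (F y - F x) - 1 / (y - x))
        (-(deriv F x * deriv F y) / (F y - F x) ^ 2 + 1 / (y - x) ^ 2) y := by
      intro y hy
      have hxy : x < y := by linarith [hx.2, hy.1]
      have h1 : F y - F x ≠ 0 := (sub_pos.2 (hm hxy)).ne'
      have h2 : y - x ≠ 0 := (sub_pos.2 hxy).ne'
      have h3 := ((hasDerivAt_const y (deriv F x)).div ((hF y).hasDerivAt.sub_const (F x)) h1).sub
        ((hasDerivAt_const y (1 : ℝ)).div ((hasDerivAt_id y).sub_const x) h2)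
      refine h3.congr_deriv ?_
      simp only [id]
      ring
    have hmono : MonotoneOn (fun y => deriv F x / (F y - F x) - 1 / (y - x)) (Icc c d) := by
      refine monotoneOn_of_deriv_nonneg (convex_Icc c d)
        (fun t ht => (hD t ht).continuousAt.continuousWithinAt)
        (fun t ht => (hD t (interior_subset ht)).differentiableAt.differentiableWithinAt) ?_
      intro y hy
      have hy := interior_subset hy
      have hxy : x < y := by linarith [hx.2, hy.1]
      rw [(hD y hy).deriv]
      have h1 : 0 < F y - F x := sub_pos.2 (hm hxy)
      have h2 : 0 < y - x := sub_pos.2 hxy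
      have h3 := deriv_mul_deriv_le_of_convexOn hF hpos hc hxl
        (⟨by linarith [hy.1], by linarith [hy.2]⟩ : y ∈ Ioo l r) hxy
      have h4 : deriv F x * deriv F y / (F y - F x) ^ 2 ≤ 1 / (y - x) ^ 2 := by
        rw [div_le_div_iff₀ (by positivity) (by positivity)]
        linarith
      rw [neg_div]
      linarith
    exact hmono (left_mem_Icc.2 hcd.le) (right_mem_Icc.2 hcd.le) hcd.le
  have hD : ∀ x ∈ Icc a b, HasDerivAt (fun x => (Real.log (F d - F x) - Real.log (F c - F x)) -
      (Real.log (d - x) - Real.log (c - x)))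
      ((-deriv F x / (F d - F x) - -deriv F x / (F c - F x)) - (-1 / (d - x) - -1 / (c - x))) x := by
    intro x hx
    have hxc : x < c := by linarith [hx.2]
    have h1 : F c - F x ≠ 0 := (sub_pos.2 (hm hxc)).ne'
    have h2 : F d - F x ≠ 0 := (sub_pos.2 (hm (hxc.trans hcd))).ne'
    have h3 : c - x ≠ 0 := (sub_pos.2 hxc).ne'
    have h4 : d - x ≠ 0 := (sub_pos.2 (hxc.trans hcd)).ne'
    exact ((((hF x).hasDerivAt.const_sub (F d)).log h2).sub
      (((hF x).hasDerivAt.const_sub (F c)).log h1)).sub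
      ((((hasDerivAt_id x).const_sub d).log h4).sub (((hasDerivAt_id x).const_sub c).log h3))
  have hanti : AntitoneOn (fun x => (Real.log (F d - F x) - Real.log (F c - F x)) -
      (Real.log (d - x) - Real.log (c - x))) (Icc a b) := by
    refine antitoneOn_of_deriv_nonpos (convex_Icc a b)
      (fun t ht => (hD t ht).continuousAt.continuousWithinAt)
      (fun t ht => (hD t (interior_subset ht)).differentiableAt.differentiableWithinAt) ?_
    intro x hx
    have hx := interior_subset hx
    rw [(hD x hx).deriv]
    have := key x hx
    simp only [neg_div]
    linarith
  have h0 := hanti (left_mem_Icc.2 hab.le) (right_mem_Icc.2 hab.le) hab.le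
  have p1 := sub_pos.2 (hm hab)
  have p2 := sub_pos.2 (hm hbc)
  have p3 := sub_pos.2 (hm hcd)
  have p4 := sub_pos.2 (hm (hab.trans hbc))
  have p5 := sub_pos.2 (hm (hbc.trans hcd))
  have p6 := sub_pos.2 (hm (hab.trans (hbc.trans hcd)))
  have r1 := sub_pos.2 hab
  have r2 := sub_pos.2 hbc
  have r3 := sub_pos.2 hcd
  have r4 := sub_pos.2 (hab.trans hbc)
  have r5 := sub_pos.2 (hbc.trans hcd)
  have r6 := sub_pos.2 (hab.trans (hbc.trans hcd))
  simp only at h0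
  have h1 : Real.log ((F d - F b) * (F c - F a) * ((d - a) * (c - b))) ≤
      Real.log ((d - b) * (c - a) * ((F d - F a) * (F c - F b))) := by
    rw [Real.log_mul (by positivity) (by positivity), Real.log_mul p5.ne' p4.ne',
      Real.log_mul r6.ne' r2.ne', Real.log_mul (by positivity) (by positivity),
      Real.log_mul r5.ne' r4.ne', Real.log_mul p6.ne' p2.ne']
    linarith
  have h2 := (Real.log_le_log_iff (by positivity) (by positivity)).1 h1
  -- The double integral controls (d-a)(c-b)/((c-a)(d-b)), which is one minus `crossRatio`:
  -- (c-a)(d-b) = (d-a)(c-b) + (b-a)(d-c).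
  unfold crossRatio
  rw [div_le_div_iff₀ (by positivity) (by positivity)]
  nlinarith [h2]

/-- The cross-ratio is the product of (b-a)/(c-a) and (d-c)/(d-b). The mean value theorem turns each
numerator into a derivative, which the hypothesis compares with the slope over the interval of the
denominator; each factor costs one κ. -/
theorem crossRatio_le_of_deriv_mul_le {F : ℝ → ℝ} (hF : Differentiable ℝ F) (hm : StrictMono F)
    {a b c d κ : ℝ} (hab : a < b) (hbc : b < c) (hcd : c < d)
    (h : ∀ u v x, a ≤ u → u < v → v ≤ d → x ∈ Icc u v → deriv F x * (v - u) ≤ κ * (F v - F u)) :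
    crossRatio (F a) (F b) (F c) (F d) ≤ κ ^ 2 * crossRatio a b c d := by
  have p1 := sub_pos.2 (hm hab)
  have p3 := sub_pos.2 (hm hcd)
  have p4 := sub_pos.2 (hm (hab.trans hbc))
  have p5 := sub_pos.2 (hm (hbc.trans hcd))
  have r1 := sub_pos.2 hab
  have r3 := sub_pos.2 hcd
  have r4 := sub_pos.2 (hab.trans hbc)
  have r5 := sub_pos.2 (hbc.trans hcd)
  obtain ⟨x, hx, hx'⟩ := exists_deriv_eq_slope F hab hF.continuous.continuousOn hF.differentiableOn
  obtain ⟨y, hy, hy'⟩ := exists_deriv_eq_slope F hcd hF.continuous.continuousOn hF.differentiableOn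
  have h1 := h a c x le_rfl (hab.trans hbc) hcd.le ⟨hx.1.le, hx.2.le.trans hbc.le⟩
  have h2 := h b d y hab.le (hbc.trans hcd) le_rfl ⟨hbc.le.trans hy.1.le, hy.2.le⟩
  rw [hx', div_mul_eq_mul_div, div_le_iff₀ r1] at h1
  rw [hy', div_mul_eq_mul_div, div_le_iff₀ r3] at h2
  have e1 : (F b - F a) / (F c - F a) ≤ κ * ((b - a) / (c - a)) := by
    rw [div_le_iff₀ p4, ← mul_div_assoc, div_mul_eq_mul_div, le_div_iff₀ r4]
    linarith
  have e2 : (F d - F c) / (F d - F b) ≤ κ * ((d - c) / (d - b)) := by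
    rw [div_le_iff₀ p5, ← mul_div_assoc, div_mul_eq_mul_div, le_div_iff₀ r5]
    linarith
  calc crossRatio (F a) (F b) (F c) (F d)
      = (F b - F a) / (F c - F a) * ((F d - F c) / (F d - F b)) := by
        unfold crossRatio; field_simp
    _ ≤ (κ * ((b - a) / (c - a))) * (κ * ((d - c) / (d - b))) :=
        mul_le_mul e1 e2 (by positivity) (le_trans (by positivity) e1)
    _ = κ ^ 2 * crossRatio a b c d := by unfold crossRatio; field_simp

/-! ### Power-law critical points -/

theorem deriv_mul_le_of_powerLaw {F : ℝ → ℝ} (hF : Differentiable ℝ F) (hm : StrictMono F)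
    {c r α β s : ℝ} (hα : 0 < α) (hs : 1 < s)
    (hl : ∀ x, |x - c| < r → α * |x - c| ^ (s - 1) ≤ deriv F x)
    (hu : ∀ x, |x - c| < r → deriv F x ≤ β * |x - c| ^ (s - 1))
    (hβ : 0 < β) {a b x : ℝ} (hab : a < b) (ha : |a - c| < r) (hb : |b - c| < r)
    (hx : x ∈ Icc a b) :
    deriv F x * (b - a) ≤ 4 * 2 ^ (s - 1) * β / α * (F b - F a) := by
  -- M is the larger distance from c to an endpoint, and [u, v] is the quarter of [a, b] at that
  -- endpoint. Since b - a ≤ 2M, points there stay M/2 away from c, where F' is comparable with its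
  -- maximum.
  have key : ∀ M, 0 < M → |x - c| ≤ M → ∀ u v, a ≤ u → u < v → v ≤ b → v - u = (b - a) / 4 →
      (∀ y ∈ Ioo u v, M / 2 ≤ |y - c|) →
      deriv F x * (b - a) ≤ 4 * 2 ^ (s - 1) * β / α * (F b - F a) := by
    intro M hM hxM u v hau huv hvb hlen hy
    obtain ⟨y, hyI, hy'⟩ := exists_deriv_eq_slope F huv hF.continuous.continuousOn
      hF.differentiableOn
    have hyr : |y - c| < r := by
      rw [abs_lt] at *
      constructor <;> linarith [hyI.1, hyI.2]
    have hxr : |x - c| < r := by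
      rw [abs_lt] at *
      constructor <;> linarith [hx.1, hx.2]
    have h1 : α * (M / 2) ^ (s - 1) ≤ deriv F y :=
      le_trans (by gcongr; exact hy y hyI) (hl y hyr)
    have h2 : deriv F x ≤ β * M ^ (s - 1) :=
      (hu x hxr).trans (by gcongr)
    have huv' := sub_pos.2 huv
    rw [hy', le_div_iff₀ huv', hlen, Real.div_rpow hM.le (by norm_num)] at h1
    have h3 : F v - F u ≤ F b - F a := by
      linarith [hm.monotone hau, hm.monotone hvb]
    have hab' := sub_pos.2 hab
    have h4 : 0 < (2 : ℝ) ^ (s - 1) := by positivity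
    calc deriv F x * (b - a) ≤ β * M ^ (s - 1) * (b - a) := by gcongr
      _ = 4 * 2 ^ (s - 1) * β / α * (α * (M ^ (s - 1) / 2 ^ (s - 1)) * ((b - a) / 4)) := by
        field_simp
      _ ≤ _ := by
        gcongr
        exact h1.trans h3
  rcases le_total |a - c| |b - c| with h | h
  · have hbc : 0 < b - c := by
      by_contra hn
      rw [abs_of_nonpos (not_lt.1 hn), abs_of_nonpos (by linarith)] at h
      linarith
    rw [abs_of_pos hbc] at h
    have h' := abs_le.1 h
    refine key (b - c) hbc (abs_le.2 ⟨by linarith [hx.1], by linarith [hx.2]⟩) (b - (b - a) / 4) b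
      (by linarith) (by linarith) le_rfl (by ring) ?_
    intro y hy
    exact le_trans (by linarith [hy.1]) (le_abs_self _)
  · have hbc : 0 < c - a := by
      by_contra hn
      rw [abs_of_nonneg (by linarith : 0 ≤ a - c), abs_of_nonneg (by linarith)] at h
      linarith
    rw [abs_sub_comm a c, abs_of_pos hbc] at h
    have h' := abs_le.1 h
    refine key (c - a) hbc (abs_le.2 ⟨by linarith [hx.1], by linarith [hx.2]⟩) a (a + (b - a) / 4)
      le_rfl (by linarith) (by linarith) (by ring) ?_
    intro y hy
    exact le_trans (by linarith [hy.2]) (neg_le_abs _)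

/-- The left side is at most of order (tD)^s and the right increment at least of order D^s. The
quotient t^s is t times t^{s-1}, and the second factor is as small as desired because s > 1. -/
theorem exists_sub_le_mul_of_powerLaw {F : ℝ → ℝ} (hF : Differentiable ℝ F) (hm : StrictMono F)
    {c r α β s : ℝ} (hr : 0 < r) (hα : 0 < α) (hs : 1 < s)
    (hl : ∀ x, |x - c| < r → α * |x - c| ^ (s - 1) ≤ deriv F x)
    (hu : ∀ x, |x - c| < r → deriv F x ≤ β * |x - c| ^ (s - 1))
    (hβ : 0 < β) {κ : ℝ} (hκ : 0 < κ) :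
    ∃ t₀ > 0, ∀ t, 0 < t → t ≤ t₀ → ∀ D, 0 < D → D ≤ 1 →
      F c - F (c - t * D) ≤ κ * t * (F (c + D) - F c) := by
  -- The power law is known only within r of c while D may be as large as 1, so the lower bound is
  -- taken at c + ρD.
  set C := 4 * 2 ^ (s - 1) * β / α with hC
  have hCp : 0 < C := by positivity
  set ρ := min 1 (r / 2) with hρ
  have hρp : 0 < ρ := by positivity
  have hρ1 : ρ ≤ 1 := min_le_left _ _
  have hρr : ρ ≤ r / 2 := min_le_right _ _
  set A := β * C / (α * ρ ^ s) with hA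
  have hAp : 0 < A := by positivity
  have hs0 : 0 < s - 1 := by linarith
  refine ⟨min (r / 2) ((κ / A) ^ (1 / (s - 1))), by positivity, ?_⟩
  intro t ht htt D hD hD1
  have ht1 : t ≤ r / 2 := htt.trans (min_le_left _ _)
  have ht2 : t ^ (s - 1) ≤ κ / A := by
    have := Real.rpow_le_rpow ht.le (htt.trans (min_le_right _ _)) hs0.le
    rwa [← Real.rpow_mul (by positivity), one_div_mul_cancel hs0.ne', Real.rpow_one] at this
  have htD : 0 < t * D := by positivity
  have htDr : t * D ≤ r / 2 := by nlinarith
  have h1 : F c - F (c - t * D) ≤ β * (t * D) ^ (s - 1) * (t * D) := by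
    obtain ⟨y, hyI, hy'⟩ := exists_deriv_eq_slope F (show c - t * D < c by linarith)
      hF.continuous.continuousOn hF.differentiableOn
    have hy1 : |y - c| ≤ t * D := by rw [abs_le]; constructor <;> linarith [hyI.1, hyI.2]
    have h2 : deriv F y ≤ β * (t * D) ^ (s - 1) :=
      (hu y (by linarith)).trans (by gcongr)
    rw [hy', sub_sub_cancel, div_le_iff₀ htD] at h2
    exact h2
  have hE : 0 < ρ * D := by positivity
  have hEr : ρ * D ≤ r / 2 := by nlinarith
  have h2 : α * (ρ * D) ^ (s - 1) * (ρ * D) ≤ C * (F (c + D) - F c) := by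
    have e : |c + ρ * D - c| = ρ * D := by rw [add_sub_cancel_left, abs_of_pos hE]
    have h3 := deriv_mul_le_of_powerLaw hF hm hα hs hl hu hβ (show c < c + ρ * D by linarith)
      (by simpa using hr) (by rw [e]; linarith) (right_mem_Icc.2 (by linarith))
    have h4 := hl (c + ρ * D) (by rw [e]; linarith)
    rw [e] at h4
    rw [add_sub_cancel_left] at h3
    have h5 : F (c + ρ * D) ≤ F (c + D) := hm.monotone (by nlinarith)
    calc _ ≤ deriv F (c + ρ * D) * (ρ * D) := by gcongr
      _ ≤ C * (F (c + ρ * D) - F c) := h3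
      _ ≤ _ := by gcongr
  rw [mul_assoc, ← Real.rpow_add_one hE.ne', sub_add_cancel, Real.mul_rpow hρp.le hD.le] at h2
  have h6 : β * (t * D) ^ (s - 1) * (t * D) = t ^ (s - 1) * t * A / C * (α * (ρ ^ s * D ^ s)) := by
    rw [Real.mul_rpow ht.le hD.le]
    have : D ^ s = D ^ (s - 1) * D := by rw [← Real.rpow_add_one hD.ne', sub_add_cancel]
    rw [this, hA]
    field_simp
  calc F c - F (c - t * D) ≤ _ := h1
    _ = _ := h6
    _ ≤ (κ / A) * t * A / C * (C * (F (c + D) - F c)) := by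
      gcongr
    _ = _ := by field_simp

theorem deriv_neg_comp_neg (F : ℝ → ℝ) (x : ℝ) :
    deriv (fun y => -F (-y)) x = deriv F (-x) := by
  rw [deriv.fun_neg, deriv_comp_neg, neg_neg]

theorem exists_sub_le_mul_of_powerLaw' {F : ℝ → ℝ} (hF : Differentiable ℝ F) (hm : StrictMono F)
    {c r α β s : ℝ} (hr : 0 < r) (hα : 0 < α) (hs : 1 < s)
    (hl : ∀ x, |x - c| < r → α * |x - c| ^ (s - 1) ≤ deriv F x)
    (hu : ∀ x, |x - c| < r → deriv F x ≤ β * |x - c| ^ (s - 1))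
    (hβ : 0 < β) {κ : ℝ} (hκ : 0 < κ) :
    ∃ t₀ > 0, ∀ t, 0 < t → t ≤ t₀ → ∀ D, 0 < D → D ≤ 1 →
      F (c + t * D) - F c ≤ κ * t * (F c - F (c - D)) := by
  have e : ∀ x : ℝ, |x - -c| = |-x - c| := fun x => by rw [← abs_neg]; congr 1; ring
  obtain ⟨t₀, ht₀, h⟩ := exists_sub_le_mul_of_powerLaw (F := fun y => -F (-y)) (c := -c)
    (by fun_prop) (fun x y hxy => neg_lt_neg (hm (neg_lt_neg hxy))) hr hα hs
    (fun x hx => by rw [e] at hx ⊢; rw [deriv_neg_comp_neg]; exact hl _ hx)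
    (fun x hx => by rw [e] at hx ⊢; rw [deriv_neg_comp_neg]; exact hu _ hx) hβ hκ
  refine ⟨t₀, ht₀, fun t h1 h2 D h3 h4 => ?_⟩
  have := h t h1 h2 D h3 h4
  simp only [neg_neg] at this
  have e1 : -(-c - t * D) = c + t * D := by ring
  have e2 : -(-c + D) = c - D := by ring
  rw [e1, e2] at this
  linarith

/-! ### Distortion of a single iterate -/

/-- A lift to the real line of a multicritical circle map. -/
structure IsMulticriticalLift (F : CircleDeg1Lift) : Prop where
  contDiff : ContDiff ℝ 3 F
  strictMono : StrictMono F
  finite : ∃ S : Finset ℝ, ∀ x, deriv F x = 0 ↔ ∃ c ∈ S, ∃ m : ℤ, x = c + m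
  nonflat : ∀ c, deriv F c = 0 → ∃ r > 0,
    (∀ x, |x - c| < r → x ≠ c → schwarzian F x < 0) ∧
      ∃ α β s : ℝ, 0 < α ∧ 0 < β ∧ 1 < s ∧ ∀ x, |x - c| < r →
        α * |x - c| ^ (s - 1) ≤ deriv F x ∧ deriv F x ≤ β * |x - c| ^ (s - 1)

/-- The distortion of cross-ratios under `F` and the flatness of `F` at the points of `S + ℤ`. -/
structure HasDistortionBounds (F : ℝ → ℝ) (S : Finset ℝ) (B Λ δ : ℝ) : Prop where
  crossRatio_le : ∀ a b c d, a < b → b < c → c < d → d ≤ a + 3 →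
    crossRatio (F a) (F b) (F c) (F d) ≤ B * crossRatio a b c d
  crossRatio_le_exp : ∀ a b c d, a < b → b < c → c < d → d < a + δ →
    (∀ p ∈ S, ∀ m : ℤ, p + m ∉ Icc a d) →
    crossRatio (F a) (F b) (F c) (F d) ≤ Real.exp (Λ * (d - a)) * crossRatio a b c d
  flat : ∀ p ∈ S, ∀ κ > 0, ∃ t₀ > 0, ∀ t, 0 < t → t ≤ t₀ → ∀ D, 0 < D → D ≤ 1 →
    F p - F (p - t * D) ≤ κ * t * (F (p + D) - F p) ∧
    F (p + t * D) - F p ≤ κ * t * (F p - F (p - D))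

theorem deriv_add_int (F : CircleDeg1Lift) (x : ℝ) (m : ℤ) : deriv F (x + m) = deriv F x := by
  have : (fun y => F (y + m)) = fun y => F y + m := funext fun y => F.map_add_int y m
  rw [← deriv_comp_add_const, this, deriv_add_const]

theorem deriv_deriv_add_int (F : CircleDeg1Lift) (x : ℝ) (m : ℤ) :
    deriv (deriv F) (x + m) = deriv (deriv F) x := by
  have : (fun y => deriv F (y + m)) = fun y => deriv F y := funext fun y => deriv_add_int F y m
  rw [← deriv_comp_add_const, this]

theorem exists_le_of_continuous_of_forall_add_int {g : ℝ → ℝ} (hg : Continuous g)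
    (hp : ∀ x (m : ℤ), g (x + m) = g x) : ∃ y, ∀ x, g y ≤ g x := by
  obtain ⟨y, -, hy⟩ := isCompact_Icc.exists_isMinOn (nonempty_Icc.2 (zero_le_one (α := ℝ)))
    hg.continuousOn
  refine ⟨y, fun x => ?_⟩
  have h := hp (Int.fract x) ⌊x⌋
  rw [Int.fract_add_floor] at h
  rw [h]
  exact hy ⟨Int.fract_nonneg x, (Int.fract_lt_one x).le⟩

theorem exists_abs_le_of_continuous_of_forall_add_int {g : ℝ → ℝ} (hg : Continuous g)
    (hp : ∀ x (m : ℤ), g (x + m) = g x) : ∃ K > 0, ∀ x, |g x| ≤ K := by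
  obtain ⟨y, hy⟩ := exists_le_of_continuous_of_forall_add_int (g := fun x => -|g x|)
    (by fun_prop) (fun x m => by rw [hp])
  exact ⟨|g y| + 1, by positivity, fun x => by linarith [hy x]⟩

namespace IsMulticriticalLift

variable {F : CircleDeg1Lift}

theorem contDiff_deriv (hF : IsMulticriticalLift F) : ContDiff ℝ 2 (deriv F) :=
  ((contDiff_succ_iff_deriv (n := 2)).1 (by exact_mod_cast hF.contDiff)).2.2

theorem contDiff_deriv_deriv (hF : IsMulticriticalLift F) : ContDiff ℝ 1 (deriv (deriv F)) :=
  ((contDiff_succ_iff_deriv (n := 1)).1 (by exact_mod_cast hF.contDiff_deriv)).2.2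

theorem differentiable (hF : IsMulticriticalLift F) : Differentiable ℝ F :=
  hF.contDiff.differentiable (by norm_num)

theorem deriv_nonneg (_ : IsMulticriticalLift F) (x : ℝ) : 0 ≤ deriv F x :=
  F.monotone.deriv_nonneg

/-- There are finitely many critical points modulo ℤ, and F' and the Schwarzian derivative are
periodic, so the local constants can be made uniform. -/
theorem exists_uniform (hF : IsMulticriticalLift F) : ∃ r > 0, ∃ C > 0, ∀ c, deriv F c = 0 →
    (∀ x, |x - c| < r → x ≠ c → schwarzian F x < 0 ∧ 0 < deriv F x) ∧
    ∀ a b x, a < b → |a - c| < r → |b - c| < r → x ∈ Icc a b →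
      deriv F x * (b - a) ≤ C * (F b - F a) := by
  obtain ⟨S, hS⟩ := hF.finite
  have h0 : ∀ c ∈ S, deriv F c = 0 := fun c hc => (hS c).2 ⟨c, hc, 0, by simp⟩
  have h1 : ∀ c ∈ S, ∃ r > 0, ∃ C > 0,
    (∀ x, |x - c| < r → x ≠ c → schwarzian F x < 0 ∧ 0 < deriv F x) ∧
    ∀ a b x, a < b → |a - c| < r → |b - c| < r → x ∈ Icc a b →
      deriv F x * (b - a) ≤ C * (F b - F a) := by
    intro c hc
    obtain ⟨r, hr, h2, α, β, s, hα, hβ, hs, h3⟩ := hF.nonflat c (h0 c hc)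
    refine ⟨r, hr, 4 * 2 ^ (s - 1) * β / α, by positivity, fun x hx hxc => ⟨h2 x hx hxc, ?_⟩, ?_⟩
    · refine lt_of_lt_of_le ?_ (h3 x hx).1
      have : 0 < |x - c| := abs_pos.2 (sub_ne_zero.2 hxc)
      positivity
    · intro a b x hab ha hb hx
      exact deriv_mul_le_of_powerLaw hF.differentiable hF.strictMono hα hs
        (fun x hx => (h3 x hx).1) (fun x hx => (h3 x hx).2) hβ hab ha hb hx
  choose! r hr C hC h2 using h1
  have h3 : ∃ ρ > 0, ∀ c ∈ S, ρ ≤ r c := by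
    have : ∀ᶠ ρ in 𝓝[>] (0 : ℝ), ∀ c ∈ S, ρ ≤ r c := by
      rw [Filter.eventually_all_finset]
      intro c hc
      filter_upwards [Ioo_mem_nhdsGT (hr c hc)] with x hx using hx.2.le
    exact (this.and self_mem_nhdsWithin).exists.imp fun ρ h => ⟨h.2, h.1⟩
  have h4 : ∃ K > 0, ∀ c ∈ S, C c ≤ K := by
    have : ∀ᶠ K in Filter.atTop, ∀ c ∈ S, C c ≤ K := by
      rw [Filter.eventually_all_finset]
      intro c hc
      exact Filter.eventually_ge_atTop _
    exact (this.and (Filter.eventually_gt_atTop 0)).exists.imp fun ρ h => ⟨h.2, h.1⟩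
  obtain ⟨ρ, hρ, hρr⟩ := h3
  obtain ⟨K, hK, hKC⟩ := h4
  refine ⟨ρ, hρ, K, hK, fun c hc => ?_⟩
  obtain ⟨p, hp, m, rfl⟩ := (hS c).1 hc
  have e : ∀ x : ℝ, x - (p + m) = (x - m) - p := fun x => by ring
  have e1 : ∀ x : ℝ, x = (x - m) + m := fun x => by ring
  have hsch : ∀ x : ℝ, schwarzian F x = schwarzian F (x - m) := by
    intro x
    unfold schwarzian
    have h5 : ∀ y : ℝ, deriv F (y - m) = deriv F y := fun y => by
      rw [← deriv_add_int F (y - m) m, sub_add_cancel]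
    have h6 : ∀ y : ℝ, deriv (deriv F) (y - m) = deriv (deriv F) y := fun y => by
      rw [← deriv_deriv_add_int F (y - m) m, sub_add_cancel]
    rw [h5, h6, ← deriv_comp_sub_const]
    simp only [h5, h6]
  obtain ⟨h5, h6⟩ := h2 p hp
  constructor
  · intro x hx hxc
    rw [e] at hx
    have := h5 (x - m) (hx.trans_le (hρr p hp)) (fun h => hxc (by rw [← h]; ring))
    rwa [← hsch, ← deriv_add_int F (x - m) m, sub_add_cancel] at this
  · intro a b x hab ha hb hx
    rw [e] at ha hb
    have := h6 (a - m) (b - m) (x - m) (by linarith) (ha.trans_le (hρr p hp))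
      (hb.trans_le (hρr p hp)) ⟨by linarith [hx.1], by linarith [hx.2]⟩
    rw [← deriv_add_int F (x - m) m, sub_add_cancel, F.map_sub_int, F.map_sub_int] at this
    have h7 : 0 ≤ F b - F a := sub_nonneg.2 (F.monotone hab.le)
    calc _ = deriv F x * (b - m - (a - m)) := by ring
      _ ≤ _ := this
      _ = C p * (F b - F a) := by ring
      _ ≤ K * (F b - F a) := by gcongr; exact hKC p hp

theorem exists_le_deriv (hF : IsMulticriticalLift F) {r : ℝ} (hr : 0 < r) :
    ∃ ε > 0, ∀ x, (∀ c, deriv F c = 0 → r ≤ |x - c|) → ε ≤ deriv F x := by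
  set A : Set ℝ := Icc 0 1 ∩ ⋂ c ∈ {c | deriv F c = 0}, {x | r ≤ |x - c|} with hA
  have hAc : IsCompact A := isCompact_Icc.inter_right
    (isClosed_biInter fun c _ => isClosed_le continuous_const (by fun_prop))
  have hred : ∀ x, (∀ c, deriv F c = 0 → r ≤ |x - c|) → Int.fract x ∈ A := by
    intro x hx
    refine ⟨⟨Int.fract_nonneg x, (Int.fract_lt_one x).le⟩, mem_iInter₂.2 fun c hc => ?_⟩
    have := hx (c + ⌊x⌋) (by rw [deriv_add_int]; exact hc)
    rw [← Int.self_sub_floor]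
    rwa [sub_add_eq_sub_sub_swap] at this
  have hfr : ∀ x, deriv F (Int.fract x) = deriv F x := fun x => by
    rw [← deriv_add_int F _ ⌊x⌋, Int.fract_add_floor]
  rcases A.eq_empty_or_nonempty with h | h
  · refine ⟨1, one_pos, fun x hx => ?_⟩
    have := hred x hx
    rw [h] at this
    exact this.elim
  · obtain ⟨y, hy, hmin⟩ := hAc.exists_isMinOn h hF.contDiff_deriv.continuous.continuousOn
    refine ⟨deriv F y, lt_of_le_of_ne (hF.deriv_nonneg y) fun h0 => ?_, fun x hx => ?_⟩
    · have := mem_iInter₂.1 hy.2 y h0.symm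
      simp only [mem_ofPred_eq, sub_self, abs_zero] at this
      linarith
    · rw [← hfr x]
      exact hmin (hred x hx)

theorem exists_hasDistortionBounds (hF : IsMulticriticalLift F) :
    ∃ S : Finset ℝ, (∀ x, deriv F x = 0 ↔ ∃ c ∈ S, ∃ m : ℤ, x = c + m) ∧
      ∃ B Λ δ : ℝ, 1 ≤ B ∧ 0 < Λ ∧ 0 < δ ∧ HasDistortionBounds F S B Λ δ := by
  obtain ⟨S, hS⟩ := hF.finite
  obtain ⟨r, hr, C, hC, hloc⟩ := hF.exists_uniform
  obtain ⟨ε, hε, hεF⟩ := hF.exists_le_deriv (half_pos hr)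
  obtain ⟨K, hK, hKF⟩ := exists_abs_le_of_continuous_of_forall_add_int
    hF.contDiff_deriv.continuous (deriv_add_int F)
  obtain ⟨K₂, hK₂, hKF₂⟩ := exists_abs_le_of_continuous_of_forall_add_int
    hF.contDiff_deriv_deriv.continuous (deriv_deriv_add_int F)
  obtain ⟨y, hy⟩ := exists_le_of_continuous_of_forall_add_int (g := fun x => F (x + r / 2) - F x)
    (by have := hF.differentiable.continuous; fun_prop)
    (fun x m => by rw [add_right_comm, F.map_add_int, F.map_add_int]; ring)
  set m₀ := F (y + r / 2) - F y with hm₀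
  have hm₀p : 0 < m₀ := sub_pos.2 (hF.strictMono (by linarith))
  -- The entries serve intervals near a critical point (C), away from all of them (K/ε), and of
  -- length between r/2 and 3 (3K/m₀, as such an interval has image of length at least m₀).
  set κ := max 1 (max C (max (K / ε) (K * 3 / m₀))) with hκ
  have hmono : ∀ {a b : ℝ}, a < b → 0 < F b - F a := fun h => sub_pos.2 (hF.strictMono h)
  have hDle : ∀ x, deriv F x ≤ K := fun x => (le_abs_self _).trans (hKF x)
  have hnear : ∀ a b, b - a < r / 2 → (∃ c, deriv F c = 0 ∧ |a - c| < r ∧ |b - c| < r) ∨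
      ∀ x ∈ Icc a b, ε ≤ deriv F x := by
    intro a b hab
    by_cases h : ∃ x ∈ Icc a b, ∃ c, deriv F c = 0 ∧ |x - c| < r / 2
    · obtain ⟨x, hx, c, hc, hxc⟩ := h
      refine Or.inl ⟨c, hc, ?_, ?_⟩ <;>
      · rw [abs_lt] at *
        constructor <;> linarith [hx.1, hx.2]
    · push Not at h
      exact Or.inr fun x hx => hεF x (h x hx)
  have hslope : ∀ a b, a < b → (∀ x ∈ Icc a b, ε ≤ deriv F x) → ε * (b - a) ≤ F b - F a := by
    intro a b hab h
    obtain ⟨x, hx, hx'⟩ := exists_deriv_eq_slope F hab hF.differentiable.continuous.continuousOn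
      hF.differentiable.differentiableOn
    have := h x (Ioo_subset_Icc_self hx)
    rwa [hx', le_div_iff₀ (sub_pos.2 hab)] at this
  have hgap : ∀ a b x, a < b → b ≤ a + 3 → x ∈ Icc a b →
      deriv F x * (b - a) ≤ κ * (F b - F a) := by
    intro a b x hab hab3 hx
    have hab' := sub_pos.2 hab
    have hFab := hmono hab
    by_cases hlong : r / 2 ≤ b - a
    · have h1 : m₀ ≤ F b - F a := (hy a).trans
        (by linarith [hF.strictMono.monotone (show a + r / 2 ≤ b by linarith)])
      calc deriv F x * (b - a) ≤ K * 3 := mul_le_mul (hDle x) (by linarith) hab'.le hK.le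
        _ = K * 3 / m₀ * m₀ := by field_simp
        _ ≤ κ * (F b - F a) := by
          gcongr
          simp [hκ]
    · rcases hnear a b (not_le.1 hlong) with ⟨c, hc, ha, hb⟩ | h
      · refine ((hloc c hc).2 a b x hab ha hb hx).trans ?_
        gcongr
        simp [hκ]
      · calc deriv F x * (b - a) ≤ K * (b - a) := by gcongr; exact hDle x
          _ = K / ε * (ε * (b - a)) := by field_simp
          _ ≤ κ * (F b - F a) := by
            gcongr
            · simp [hκ]
            · exact hslope a b hab h
  -- Where F' ≥ ε, the bound on F'' makes log F' Lipschitz, so the loss is exponential in the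
  -- length; the cross-ratio lemma squares it, whence the factor 2 in Λ.
  have hlip : ∀ a d, a < d → (∀ x ∈ Icc a d, ε ≤ deriv F x) → ∀ u v x, a ≤ u → u < v → v ≤ d →
      x ∈ Icc u v → deriv F x * (v - u) ≤ Real.exp (K₂ / ε * (d - a)) * (F v - F u) := by
    intro a d had h u v x hu huv hv hx
    obtain ⟨z, hz, hz'⟩ := exists_deriv_eq_slope F huv hF.differentiable.continuous.continuousOn
      hF.differentiable.differentiableOn
    have huv' := sub_pos.2 huv
    have h1 : |deriv F x - deriv F z| ≤ K₂ * |x - z| :=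
      Convex.norm_image_sub_le_of_norm_deriv_le (f := deriv F) (s := univ) (x := z) (y := x)
        (fun y _ => (hF.contDiff_deriv.differentiable (by norm_num)) y)
        (fun y _ => hKF₂ y) convex_univ trivial trivial
    have h2 : |x - z| ≤ d - a := by
      rw [abs_le]; constructor <;> linarith [hx.1, hx.2, hz.1, hz.2]
    have h3 : ε ≤ deriv F z := h z ⟨by linarith [hz.1], by linarith [hz.2]⟩
    have h4 : deriv F x ≤ (1 + K₂ / ε * (d - a)) * deriv F z := by
      have h5 : K₂ * (d - a) ≤ K₂ / ε * (d - a) * deriv F z := by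
        calc K₂ * (d - a) = K₂ / ε * (d - a) * ε := by field_simp
          _ ≤ _ := by
            have : 0 < d - a := sub_pos.2 had
            gcongr
      have h6 := (le_abs_self _).trans (h1.trans (mul_le_mul_of_nonneg_left h2 hK₂.le))
      linarith
    have h5 : deriv F z * (v - u) = F v - F u := by rw [hz']; field_simp
    calc deriv F x * (v - u) ≤ Real.exp (K₂ / ε * (d - a)) * deriv F z * (v - u) := by
          gcongr
          refine h4.trans ?_
          gcongr
          · linarith
          · linarith [Real.add_one_le_exp (K₂ / ε * (d - a))]
      _ = _ := by rw [mul_assoc, h5]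
  refine ⟨S, hS, κ ^ 2, 2 * (K₂ / ε), r / 2, one_le_pow₀ (le_max_left _ _), by positivity,
    by positivity, ⟨?_, ?_, ?_⟩⟩
  · intro a b c d hab hbc hcd had
    exact crossRatio_le_of_deriv_mul_le hF.differentiable hF.strictMono hab hbc hcd
      fun u v x hu huv hv hx => hgap u v x huv (by linarith) hx
  · intro a b c d hab hbc hcd had hcrit
    have had' : a < d := by linarith
    have hcr := crossRatio_pos hab hbc hcd
    rcases hnear a d (by linarith) with ⟨p, hp, ha, hd⟩ | h
    · have hpn : p ∉ Icc a d := by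
        obtain ⟨s, hs, m, rfl⟩ := (hS p).1 hp
        exact hcrit s hs m
      have h1 : (1 : ℝ) ≤ Real.exp (2 * (K₂ / ε) * (d - a)) :=
        Real.one_le_exp (by have := sub_pos.2 had'; positivity)
      have h2 : crossRatio (F a) (F b) (F c) (F d) ≤ crossRatio a b c d := by
        rw [abs_lt] at ha hd
        rcases lt_or_ge p a with hpa | hpa
        -- The quadruple misses p, so it lies in a one-sided neighbourhood where the Schwarzian
        -- derivative is negative and F' > 0.
        · have hI : ∀ x ∈ Ioo p (p + r), schwarzian F x < 0 ∧ 0 < deriv F x := fun x hx =>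
            (hloc p hp).1 x (by rw [abs_lt]; constructor <;> linarith [hx.1, hx.2]) hx.1.ne'
          exact crossRatio_le_of_convexOn hF.differentiable (fun x hx => (hI x hx).2)
            (convexOn_of_schwarzian_neg hF.contDiff (fun x hx => (hI x hx).2)
              fun x hx => (hI x hx).1) hF.strictMono hpa hab hbc hcd (by linarith)
        · have hdp : d < p := by
            by_contra hn
            exact hpn ⟨hpa, not_lt.1 hn⟩
          have hI : ∀ x ∈ Ioo (p - r) p, schwarzian F x < 0 ∧ 0 < deriv F x := fun x hx =>
            (hloc p hp).1 x (by rw [abs_lt]; constructor <;> linarith [hx.1, hx.2]) hx.2.ne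
          exact crossRatio_le_of_convexOn hF.differentiable (fun x hx => (hI x hx).2)
            (convexOn_of_schwarzian_neg hF.contDiff (fun x hx => (hI x hx).2)
              fun x hx => (hI x hx).1) hF.strictMono (by linarith) hab hbc hcd hdp
      exact h2.trans (le_mul_of_one_le_left hcr.le h1)
    · have := crossRatio_le_of_deriv_mul_le hF.differentiable hF.strictMono hab hbc hcd
        (hlip a d had' h)
      refine this.trans (le_of_eq ?_)
      rw [← Real.exp_nat_mul]
      push_cast
      ring_nf
  · intro p hp κ hκ
    obtain ⟨r, hr, -, α, β, s, hα, hβ, hs, h3⟩ := hF.nonflat p ((hS p).2 ⟨p, hp, 0, by simp⟩)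
    obtain ⟨t₁, ht₁, h1⟩ := exists_sub_le_mul_of_powerLaw hF.differentiable hF.strictMono hr hα hs
      (fun x hx => (h3 x hx).1) (fun x hx => (h3 x hx).2) hβ hκ
    obtain ⟨t₂, ht₂, h2⟩ := exists_sub_le_mul_of_powerLaw' hF.differentiable hF.strictMono hr hα hs
      (fun x hx => (h3 x hx).1) (fun x hx => (h3 x hx).2) hβ hκ
    exact ⟨min t₁ t₂, by positivity, fun t ht htt D hD hD1 =>
      ⟨h1 t ht (htt.trans (min_le_left _ _)) D hD hD1,
        h2 t ht (htt.trans (min_le_right _ _)) D hD hD1⟩⟩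

end IsMulticriticalLift

/-! ### Order and combinatorics of orbits -/

/-- The action of `ℤ × ℤ` on the line by iterates of a lift and integer translations. -/
def act (u : CircleDeg1Liftˣ) (k m : ℤ) (x : ℝ) : ℝ := (u ^ k : CircleDeg1Liftˣ) x - m

section act

variable (u : CircleDeg1Liftˣ)

@[simp] theorem act_zero_zero (x : ℝ) : act u 0 0 x = x := by simp [act]

theorem act_act (k m k' m' : ℤ) (x : ℝ) :
    act u k m (act u k' m' x) = act u (k + k') (m + m') x := by
  simp only [act, CircleDeg1Lift.map_sub_int, zpow_add, Units.val_mul, CircleDeg1Lift.mul_apply]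
  push_cast
  ring

theorem act_comm (k m k' m' : ℤ) (x : ℝ) :
    act u k m (act u k' m' x) = act u k' m' (act u k m x) := by
  rw [act_act, act_act, add_comm k, add_comm m]

theorem act_one_zero (x : ℝ) : act u 1 0 x = u x := by simp [act]

theorem act_strictMono (k m : ℤ) : StrictMono (act u k m) := fun _ _ h =>
  sub_lt_sub_right ((CircleDeg1Lift.toOrderIso (u ^ k)).strictMono h) _

theorem act_lt_act_iff' {k m : ℤ} {x y : ℝ} : act u k m x < act u k m y ↔ x < y :=
  (act_strictMono u k m).lt_iff_lt

theorem act_le_act_iff' {k m : ℤ} {x y : ℝ} : act u k m x ≤ act u k m y ↔ x ≤ y :=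
  (act_strictMono u k m).le_iff_le

theorem act_continuous (k m : ℤ) : Continuous (act u k m) := by
  have : Continuous fun x : ℝ => (u ^ k : CircleDeg1Liftˣ) x :=
    (CircleDeg1Lift.toOrderIso (u ^ k)).continuous
  unfold act
  fun_prop

theorem act_add_int (k m j : ℤ) (x : ℝ) : act u k m (x + j) = act u k m x + j := by
  simp only [act, CircleDeg1Lift.map_add_int]
  ring

theorem act_zero_left (m : ℤ) (x : ℝ) : act u 0 m x = x - m := by simp [act]

theorem act_sub (k m j : ℤ) (x : ℝ) : act u k (m + j) x = act u k m x - j := by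
  simp only [act]; push_cast; ring

theorem act_eq_sub (k m : ℤ) (x : ℝ) : act u k m x = act u k 0 x - m := by
  rw [← act_sub, zero_add]

variable {u}

/-- Orbits are ordered as for the rigid rotation. Irrationality excludes a zero displacement number,
apart from k = m = 0. -/
theorem act_lt_self_iff (h : Irrational (u : CircleDeg1Lift).translationNumber) {k m : ℤ} {x : ℝ} :
    act u k m x < x ↔ k * (u : CircleDeg1Lift).translationNumber - m < 0 := by
  have e : act u k m x < x ↔ (u ^ k : CircleDeg1Liftˣ) x < x + m := by
    simp only [act]; constructor <;> intro h <;> linarith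
  rw [e, sub_neg, ← CircleDeg1Lift.translationNumber_zpow]
  constructor
  · intro hx
    refine lt_of_le_of_ne (CircleDeg1Lift.translationNumber_le_of_le_add_int _ hx.le) fun h0 => ?_
    rw [CircleDeg1Lift.translationNumber_zpow] at h0
    rcases eq_or_ne k 0 with rfl | hk
    · have : m = 0 := by
        have : (m : ℝ) = 0 := by rw [← h0]; simp
        exact_mod_cast this
      subst this
      simp at hx
    · exact (h.intCast_mul hk).ne_int m h0
  · exact fun h => CircleDeg1Lift.map_lt_of_translationNumber_lt_int _ h x

theorem act_lt_act_iff (h : Irrational (u : CircleDeg1Lift).translationNumber) {k m k' m' : ℤ}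
    {x : ℝ} : act u k m x < act u k' m' x ↔
      k * (u : CircleDeg1Lift).translationNumber - m <
        k' * (u : CircleDeg1Lift).translationNumber - m' := by
  have : act u k m x = act u (k - k') (m - m') (act u k' m' x) := by
    rw [act_act, sub_add_cancel, sub_add_cancel]
  rw [this, act_lt_self_iff h]
  push_cast
  constructor <;> intro h <;> linarith

end act

/-- `q` and `q'` are consecutive closest return times, the first return being to the right and the
second one to the left; `p` and `p'` are the corresponding numbers of turns. -/
structure IsReturnPair (u : CircleDeg1Liftˣ) (q p q' p' : ℤ) : Prop where
  irrational : Irrational (u : CircleDeg1Lift).translationNumber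
  q_pos : 0 < q
  q_le : q ≤ q'
  pos : 0 < q * (u : CircleDeg1Lift).translationNumber - p
  lt_one : q * (u : CircleDeg1Lift).translationNumber - p < 1
  neg : q' * (u : CircleDeg1Lift).translationNumber - p' < 0
  sum_pos : 0 < (q * (u : CircleDeg1Lift).translationNumber - p) +
    (q' * (u : CircleDeg1Lift).translationNumber - p')
  best : ∀ k m : ℤ, k ≠ 0 → |k| < q' → q * (u : CircleDeg1Lift).translationNumber - p ≤
    |k * (u : CircleDeg1Lift).translationNumber - m|

namespace IsReturnPair

variable {u : CircleDeg1Liftˣ} {q p q' p' : ℤ}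

theorem lt_act (h : IsReturnPair u q p q' p') (x : ℝ) : x < act u q p x := by
  have := (act_lt_act_iff h.irrational (k := 0) (m := 0) (k' := q) (m' := p) (x := x)).2
    (by simpa using h.pos)
  rwa [act_zero_zero] at this

theorem act_lt_add_one (h : IsReturnPair u q p q' p') (x : ℝ) : act u q p x < x + 1 := by
  have := (act_lt_act_iff h.irrational (k' := 0) (m' := -1) (k := q) (m := p) (x := x)).2
    (by simpa using h.lt_one)
  rw [act_zero_left] at this
  simpa using this

theorem act_neg_lt (h : IsReturnPair u q p q' p') (x : ℝ) : act u (-q) (-p) x < x := by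
  have := h.lt_act (act u (-q) (-p) x)
  rw [act_act] at this
  simpa using this

@[simp] theorem act_act_neg (u : CircleDeg1Liftˣ) (q p : ℤ) (x : ℝ) :
    act u q p (act u (-q) (-p) x) = x := by
  rw [act_act]; simp

@[simp] theorem act_neg_act (u : CircleDeg1Liftˣ) (q p : ℤ) (x : ℝ) :
    act u (-q) (-p) (act u q p x) = x := by
  rw [act_act]; simp

theorem act'_lt (h : IsReturnPair u q p q' p') (x : ℝ) : act u q' p' x < x := by
  have := (act_lt_act_iff h.irrational (k := q') (m := p') (k' := 0) (m' := 0) (x := x)).2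
    (by simpa using h.neg)
  rwa [act_zero_zero] at this

theorem act_neg_lt_act' (h : IsReturnPair u q p q' p') (x : ℝ) :
    act u (-q) (-p) x < act u q' p' x := by
  rw [act_lt_act_iff h.irrational]
  have := h.sum_pos
  push_cast
  linarith

/-- Overlapping arcs would give |(i-j)τ - (m-l)| < qτ - p, against `best` when i ≠ j; when i = j,
`lt_one` forces m = l. -/
theorem eq_of_mem_Ico (h : IsReturnPair u q p q' p') {i j m l : ℤ} (hi0 : 0 ≤ i) (hi : i < q')
    (hj0 : 0 ≤ j) (hj : j < q') {x y : ℝ} (hy : y ∈ Ico (act u i m x) (act u i m (act u q p x)))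
    (hy' : y ∈ Ico (act u j l x) (act u j l (act u q p x))) : i = j ∧ m = l := by
  have h1 := hy.1.trans_lt hy'.2
  have h2 := hy'.1.trans_lt hy.2
  rw [act_act, act_lt_act_iff h.irrational] at h1 h2
  push_cast at h1 h2
  have h3 : |((i - j : ℤ) : ℝ) * (u : CircleDeg1Lift).translationNumber - (m - l : ℤ)| <
      q * (u : CircleDeg1Lift).translationNumber - p := by
    rw [abs_lt]; push_cast; constructor <;> linarith
  have hij : i = j := by
    by_contra hne
    exact absurd (h.best (i - j) (m - l) (sub_ne_zero.2 hne) (by rw [abs_lt]; omega)) (not_le.2 h3)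
  refine ⟨hij, ?_⟩
  subst hij
  have h4 := h3.trans h.lt_one
  simp only [sub_self, Int.cast_zero, zero_mul, zero_sub, abs_neg] at h4
  have h5 : |m - l| < 1 := by exact_mod_cast h4
  have := Int.abs_lt_one_iff.1 h5
  omega

/-- Take the highest point not above z among the translates of the first q + q' iterates. Were it
below the inverse G-image of z, either G (for i < q') or the inverse of H (for i ≥ q') would give a
higher one, still not above z and with an admissible index. -/
theorem exists_act_mem_Icc (h : IsReturnPair u q p q' p') (x z : ℝ) :
    ∃ i m : ℤ, 0 ≤ i ∧ i < q + q' ∧ act u i m x ∈ Icc (act u (-q) (-p) z) z := by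
  set v : ℤ → ℝ := fun i => act u i ⌈act u i 0 x - z⌉ x with hv
  have hvz : ∀ i, v i ≤ z := fun i => by
    have := Int.le_ceil (act u i 0 x - z)
    simp only [hv]
    rw [act_eq_sub]
    linarith
  have hvm : ∀ i m, act u i m x ≤ z → act u i m x ≤ v i := fun i m hm => by
    have e := act_eq_sub u i m x
    have h1 : ⌈act u i 0 x - z⌉ ≤ m := Int.ceil_le.2 (by linarith)
    have h2 : (⌈act u i 0 x - z⌉ : ℝ) ≤ m := by exact_mod_cast h1
    simp only [hv]
    rw [act_eq_sub u i ⌈_⌉]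
    linarith
  obtain ⟨i, hi, hmax⟩ := Finset.exists_max_image (Finset.Ico 0 (q + q')) v
    ⟨0, by have := h.q_pos; have := h.q_le; simp; omega⟩
  rw [Finset.mem_Ico] at hi
  refine ⟨i, ⌈act u i 0 x - z⌉, hi.1, hi.2, ?_, hvz i⟩
  by_contra hn
  rw [not_le] at hn
  have hG : act u q p (v i) < z := by
    have := (act_lt_act_iff' u (k := q) (m := p)).2 hn
    rwa [act_act_neg] at this
  rcases lt_or_ge i q' with hiq | hiq
  · have h1 := hmax (q + i) (Finset.mem_Ico.2 ⟨by have := h.q_pos; omega, by omega⟩)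
    have h2 := hG.le
    simp only [hv] at h2
    rw [act_act] at h2
    have h3 := (hvm _ _ h2).trans h1
    simp only [hv] at h3
    rw [← act_act] at h3
    exact absurd (h.lt_act _) (not_lt.2 h3)
  · have hlt : v i < act u (-q') (-p') (v i) := by
      have := h.act'_lt (act u (-q') (-p') (v i))
      rwa [act_act_neg] at this
    have hlt2 : act u (-q') (-p') (v i) < act u q p (v i) := by
      rw [act_lt_act_iff h.irrational]
      have := h.sum_pos
      push_cast
      linarith
    have h1 := hmax (-q' + i) (Finset.mem_Ico.2 ⟨by omega, by have := h.q_pos; have := h.q_le; omega⟩)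
    have h2 := (hlt2.trans hG).le
    simp only [hv] at h2 hlt
    rw [act_act] at h2 hlt
    exact absurd (hlt.trans_le (hvm _ _ h2)) (not_lt.2 h1)

theorem sum_act_sub_act_le_one (h : IsReturnPair u q p q' p') (x : ℝ) {N : ℕ} (hN : (N : ℤ) ≤ q') :
    ∑ i ∈ Finset.range N, (act u i 0 (act u q p x) - act u i 0 x) ≤ 1 := by
  set U : Set ℝ := ⋃ i ∈ Finset.range N, Ico (act u i 0 x) (act u i 0 (act u q p x)) with hU
  have hUm : MeasurableSet U := Finset.measurableSet_biUnion _ fun i _ => measurableSet_Ico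
  have hvol : volume U = ENNReal.ofReal
      (∑ i ∈ Finset.range N, (act u i 0 (act u q p x) - act u i 0 x)) := by
    rw [hU, measure_biUnion_finset, ENNReal.ofReal_sum_of_nonneg]
    · simp
    · intro i _
      exact sub_nonneg.2 ((act_strictMono u i 0).monotone (h.lt_act x).le)
    · intro i hi j hj hij
      rw [Function.onFun, Set.disjoint_left]
      intro y hy hy'
      have hi := Finset.mem_range.1 hi
      have hj := Finset.mem_range.1 hj
      have := (h.eq_of_mem_Ico (by omega) (by omega) (by omega) (by omega) hy hy').1
      omega
    · exact fun i _ => measurableSet_Ico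
  by_contra hn
  rw [not_le] at hn
  have hlt : volume (Ioc (0 : ℝ) (0 + 1)) < volume U := by
    rw [hvol, Real.volume_Ioc]
    simp only [zero_add, sub_zero]
    exact (ENNReal.ofReal_lt_ofReal_iff (by linarith)).2 hn
  -- Blichfeldt's principle: a set of measure greater than 1 meets a nontrivial integer translate of
  -- itself, against the disjointness modulo ℤ.
  obtain ⟨a, b, hab, hd⟩ := exists_pair_mem_lattice_not_disjoint_vadd
    (isAddFundamentalDomain_Ioc one_pos 0) hUm.nullMeasurableSet hlt
  obtain ⟨y, hya, hyb⟩ := Set.not_disjoint_iff.1 hd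
  obtain ⟨y₁, hy₁, rfl⟩ := hya
  obtain ⟨y₂, hy₂, he⟩ := hyb
  obtain ⟨m, hm⟩ := AddSubgroup.mem_zmultiples_iff.1 a.2
  obtain ⟨l, hl⟩ := AddSubgroup.mem_zmultiples_iff.1 b.2
  simp only [AddSubgroup.vadd_def, vadd_eq_add, ← hm, ← hl, zsmul_eq_mul, mul_one] at he
  simp only [hU, mem_iUnion, Finset.mem_range, exists_prop] at hy₁ hy₂
  obtain ⟨i, hi, hy₁⟩ := hy₁
  obtain ⟨j, hj, hy₂⟩ := hy₂
  have h1 : (y₁ + m) ∈ Ico (act u i (-m) x) (act u i (-m) (act u q p x)) := by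
    rw [act_eq_sub, act_eq_sub u i _ (act u q p x)]
    push_cast
    constructor <;> linarith [hy₁.1, hy₁.2]
  have h2 : (y₁ + m) ∈ Ico (act u j (-l) x) (act u j (-l) (act u q p x)) := by
    rw [act_eq_sub, act_eq_sub u j _ (act u q p x)]
    push_cast
    constructor <;> linarith [hy₂.1, hy₂.2]
  have := (h.eq_of_mem_Ico (by omega) (by omega) (by omega) (by omega) h1 h2).2
  apply hab
  ext
  rw [← hm, ← hl]
  simp only [zsmul_eq_mul, mul_one]
  have : m = l := by omega
  rw [this]

end IsReturnPair

namespace IsReturnPair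

variable {u : CircleDeg1Liftˣ} {q p q' p' : ℤ}

theorem act_two_lt_add_three (h : IsReturnPair u q p q' p') (x : ℝ) :
    act u q p (act u q p x) < act u (-q) (-p) x + 3 := by
  have h1 := h.act_lt_add_one (act u q p x)
  have h2 := h.act_lt_add_one x
  have h3 := h.act_lt_add_one (act u (-q) (-p) x)
  rw [act_act_neg] at h3
  linarith

theorem sum_sub_le_three (h : IsReturnPair u q p q' p') (x : ℝ) {N : ℕ} (hN : (N : ℤ) ≤ q') :
    ∑ i ∈ Finset.range N, (act u i 0 (act u q p (act u q p x)) - act u i 0 (act u (-q) (-p) x))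
      ≤ 3 := by
  have h1 := h.sum_act_sub_act_le_one (act u q p x) hN
  have h2 := h.sum_act_sub_act_le_one x hN
  have h3 := h.sum_act_sub_act_le_one (act u (-q) (-p) x) hN
  rw [act_act_neg] at h3
  have := add_le_add (add_le_add h1 h2) h3
  rw [← Finset.sum_add_distrib, ← Finset.sum_add_distrib] at this
  refine le_trans (le_of_eq ?_) (this.trans (by norm_num))
  refine Finset.sum_congr rfl fun i _ => ?_
  ring

open Classical in
theorem card_filter_mem_le_four (h : IsReturnPair u q p q' p') (x s : ℝ) {N : ℕ}
    (hN : (N : ℤ) ≤ q') :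
    ((Finset.range N).filter fun i : ℕ => ∃ m : ℤ, s + m ∈ Icc (act u i 0 (act u (-q) (-p) x))
      (act u i 0 (act u q p (act u q p x)))).card ≤ 4 := by
  have hit : ∀ i : ℕ, (∃ m : ℤ, s + m ∈ Icc (act u i 0 (act u (-q) (-p) x))
      (act u i 0 (act u q p (act u q p x)))) → ∃ k : ℤ, k ∈ Finset.Icc (-1 : ℤ) 2 ∧ ∃ m : ℤ,
      s ∈ Ico (act u i m (act u (k * q) (k * p) x))
        (act u i m (act u q p (act u (k * q) (k * p) x))) := by
    rintro i ⟨m, hm⟩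
    have hr : ∀ y, act u i m y = act u i 0 y - m := act_eq_sub u i m
    have e1 : act u i 0 (act u (-q) (-p) x) ≤ s + m := hm.1
    have e2 := hm.2
    have e3 : act u q p (act u (-q) (-p) x) = x := act_act_neg u q p x
    by_cases h0 : s + m < act u i 0 x
    · refine ⟨-1, by simp, m, ?_⟩
      simp only [neg_one_mul, e3, hr]
      constructor <;> linarith
    by_cases h1 : s + m < act u i 0 (act u q p x)
    · refine ⟨0, by simp, m, ?_⟩
      simp only [zero_mul, act_zero_zero, hr]
      constructor <;> linarith
    by_cases h2 : s + m < act u i 0 (act u q p (act u q p x))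
    · refine ⟨1, by simp, m, ?_⟩
      simp only [one_mul, hr]
      constructor <;> linarith
    -- The closed interval is covered by half-open arcs; the fourth is needed only for its right
    -- endpoint.
    · refine ⟨2, by simp, m, ?_⟩
      have e4 : act u (2 * q) (2 * p) x = act u q p (act u q p x) := by
        rw [act_act, two_mul, two_mul]
      have := (act_lt_act_iff' u (k := i) (m := 0)).2 (h.lt_act (act u q p (act u q p x)))
      simp only [e4, hr]
      constructor <;> linarith
  choose! k hk m hm using hit
  have := Finset.card_le_card_of_injOn (s := (Finset.range N).filter fun i : ℕ => ∃ m : ℤ, s + m ∈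
    Icc (act u i 0 (act u (-q) (-p) x)) (act u i 0 (act u q p (act u q p x))))
    (t := Finset.Icc (-1 : ℤ) 2) k
    (fun i hi => hk i (Finset.mem_filter.1 hi).2) (by
      intro i hi j hj hij
      obtain ⟨hi, hi'⟩ := Finset.mem_filter.1 hi
      obtain ⟨hj, hj'⟩ := Finset.mem_filter.1 hj
      rw [Finset.mem_range] at hi hj
      have h1 := hm i hi'
      have h2 := hm j hj'
      rw [← hij] at h2
      have := (h.eq_of_mem_Ico (by omega) (by omega) (by omega) (by omega) h1 h2).1
      omega)
  simpa using this

end IsReturnPair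

/-! ### Distortion of cross-ratios along an orbit -/

/-- The bound for the distortion of cross-ratios along the orbit of a fundamental arc. -/
def orbitBound (S : Finset ℝ) (B Λ δ : ℝ) : ℝ := B ^ (⌈3 / δ⌉₊ + S.card * 4) * Real.exp (Λ * 3)

theorem one_le_orbitBound {S : Finset ℝ} {B Λ δ : ℝ} (hB : 1 ≤ B) (hΛ : 0 < Λ) :
    1 ≤ orbitBound S B Λ δ :=
  one_le_mul_of_one_le_of_one_le (one_le_pow₀ hB) (Real.one_le_exp (by positivity))

theorem act_succ (u : CircleDeg1Liftˣ) (i : ℕ) (x : ℝ) :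
    act u (i + 1 : ℕ) 0 x = u (act u i 0 x) := by
  rw [← act_one_zero, act_act]
  push_cast
  rw [add_comm]

open Classical in
-- A bad time is one at which the image of [a, d] has length at least δ (at most 3/δ times, the
-- total length being at most 3) or contains a critical point (at most four times for each). Bad
-- times cost B; the exponential factors multiply to at most exp(3Λ).
theorem HasDistortionBounds.crossRatio_act_le {u : CircleDeg1Liftˣ} {S : Finset ℝ} {B Λ δ : ℝ}
    (hD : HasDistortionBounds u S B Λ δ) (hB : 1 ≤ B) (hΛ : 0 < Λ) (hδ : 0 < δ)
    {q p q' p' : ℤ} (h : IsReturnPair u q p q' p') {x a b c d : ℝ}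
    (ha : act u (-q) (-p) x ≤ a) (hab : a < b) (hbc : b < c) (hcd : c < d)
    (hd : d ≤ act u q p (act u q p x)) {N : ℕ} (hN : (N : ℤ) ≤ q') :
    crossRatio (act u N 0 a) (act u N 0 b) (act u N 0 c) (act u N 0 d) ≤
      orbitBound S B Λ δ * crossRatio a b c d := by
  set bad : Finset ℕ := (Finset.range N).filter fun i : ℕ => δ ≤ act u i 0 d - act u i 0 a ∨
    ∃ s ∈ S, ∃ m : ℤ, s + m ∈ Icc (act u i 0 a) (act u i 0 d) with hbad
  have hmono : ∀ (i : ℕ) {y z : ℝ}, y < z → act u i 0 y < act u i 0 z := fun i _ _ hyz =>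
    act_strictMono u i 0 hyz
  have hmono' : ∀ (i : ℕ) {y z : ℝ}, y ≤ z → act u i 0 y ≤ act u i 0 z := fun i _ _ hyz =>
    (act_strictMono u i 0).monotone hyz
  have had : a < d := hab.trans (hbc.trans hcd)
  have hBp : 0 < B := by linarith
  have hlen : ∑ i ∈ Finset.range N, (act u i 0 d - act u i 0 a) ≤ 3 := by
    refine le_trans (Finset.sum_le_sum fun i _ => ?_) (h.sum_sub_le_three x hN)
    exact sub_le_sub (hmono' i hd) (hmono' i ha)
  have hcard : bad.card ≤ ⌈3 / δ⌉₊ + S.card * 4 := by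
    have hsub : bad ⊆ ((Finset.range N).filter fun i : ℕ => δ ≤ act u i 0 d - act u i 0 a) ∪
        S.biUnion fun s => (Finset.range N).filter fun i : ℕ => ∃ m : ℤ, s + m ∈
          Icc (act u i 0 (act u (-q) (-p) x)) (act u i 0 (act u q p (act u q p x))) := by
      intro i hi
      obtain ⟨hi, h1 | ⟨s, hs, m, hm⟩⟩ := Finset.mem_filter.1 hi
      · exact Finset.mem_union_left _ (Finset.mem_filter.2 ⟨hi, h1⟩)
      · refine Finset.mem_union_right _ (Finset.mem_biUnion.2 ⟨s, hs, Finset.mem_filter.2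
          ⟨hi, m, (hmono' i ha).trans hm.1, hm.2.trans (hmono' i hd)⟩⟩)
    refine (Finset.card_le_card hsub).trans ((Finset.card_union_le _ _).trans (add_le_add ?_ ?_))
    · refine Nat.cast_le.1 (le_trans ?_ (Nat.le_ceil (3 / δ)))
      rw [le_div_iff₀ hδ]
      calc _ ≤ ∑ i ∈ (Finset.range N).filter (fun i : ℕ => δ ≤ act u i 0 d - act u i 0 a),
            (act u i 0 d - act u i 0 a) := by
            rw [← nsmul_eq_mul]
            exact Finset.card_nsmul_le_sum _ _ _ fun i hi => (Finset.mem_filter.1 hi).2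
        _ ≤ ∑ i ∈ Finset.range N, (act u i 0 d - act u i 0 a) :=
            Finset.sum_le_sum_of_subset_of_nonneg (Finset.filter_subset _ _)
              fun i _ _ => (sub_pos.2 (hmono i had)).le
        _ ≤ 3 := hlen
    · exact Finset.card_biUnion_le_card_mul _ _ _ fun s _ => h.card_filter_mem_le_four x s hN
  have hstep : ∀ i < N, crossRatio (u (act u i 0 a)) (u (act u i 0 b)) (u (act u i 0 c))
      (u (act u i 0 d)) ≤ (if i ∈ bad then B else 1) *
        Real.exp (Λ * (act u i 0 d - act u i 0 a)) *
        crossRatio (act u i 0 a) (act u i 0 b) (act u i 0 c) (act u i 0 d) := by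
    intro i hi
    have hp := crossRatio_pos (hmono i hab) (hmono i hbc) (hmono i hcd)
    have hexp : 1 ≤ Real.exp (Λ * (act u i 0 d - act u i 0 a)) :=
      Real.one_le_exp (mul_nonneg hΛ.le (sub_pos.2 (hmono i had)).le)
    by_cases hib : i ∈ bad
    · rw [if_pos hib]
      refine (hD.crossRatio_le _ _ _ _ (hmono i hab) (hmono i hbc) (hmono i hcd) ?_).trans ?_
      · have h1 := h.act_two_lt_add_three (act u i 0 x)
        rw [act_comm u q p i 0, act_comm u q p i 0, act_comm u (-q) (-p) i 0] at h1
        linarith [hmono' i ha, hmono' i hd]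
      · gcongr
        exact le_mul_of_one_le_right hBp.le hexp
    · rw [if_neg hib, one_mul]
      have hn : ¬ (δ ≤ act u i 0 d - act u i 0 a ∨
          ∃ s ∈ S, ∃ m : ℤ, s + m ∈ Icc (act u i 0 a) (act u i 0 d)) := fun hh =>
        hib (Finset.mem_filter.2 ⟨Finset.mem_range.2 hi, hh⟩)
      push Not at hn
      exact hD.crossRatio_le_exp _ _ _ _ (hmono i hab) (hmono i hbc) (hmono i hcd)
        (by linarith [hn.1]) hn.2
  have hprod : ∀ n ≤ N, crossRatio (act u n 0 a) (act u n 0 b) (act u n 0 c) (act u n 0 d) ≤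
      (∏ i ∈ Finset.range n, ((if i ∈ bad then B else 1) *
        Real.exp (Λ * (act u i 0 d - act u i 0 a)))) * crossRatio a b c d := by
    intro n
    induction n with
    | zero => simp
    | succ n ih =>
      intro hn
      rw [act_succ, act_succ, act_succ, act_succ, Finset.prod_range_succ]
      refine (hstep n (by omega)).trans ?_
      have hf : 0 < (if n ∈ bad then B else 1) * Real.exp (Λ * (act u n 0 d - act u n 0 a)) := by
        split_ifs <;> positivity
      calc _ ≤ (if n ∈ bad then B else 1) * Real.exp (Λ * (act u n 0 d - act u n 0 a)) * _ :=
            mul_le_mul_of_nonneg_left (ih (by omega)) hf.le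
        _ = _ := by ring
  refine (hprod N le_rfl).trans ?_
  have hcr := crossRatio_pos hab hbc hcd
  refine mul_le_mul_of_nonneg_right ?_ hcr.le
  rw [Finset.prod_mul_distrib, ← Real.exp_sum, ← Finset.mul_sum, orbitBound]
  have e : ∏ i ∈ Finset.range N, (if i ∈ bad then B else 1) = B ^ bad.card := by
    rw [Finset.prod_ite_mem, Finset.prod_const,
      Finset.inter_eq_right.2 (Finset.filter_subset _ _)]
  rw [e]
  gcongr

theorem HasDistortionBounds.crossRatio_act_le_sq {u : CircleDeg1Liftˣ} {S : Finset ℝ} {B Λ δ : ℝ}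
    (hD : HasDistortionBounds u S B Λ δ) (hB : 1 ≤ B) (hΛ : 0 < Λ) (hδ : 0 < δ)
    {q p q' p' : ℤ} (h : IsReturnPair u q p q' p') {x a b c d : ℝ}
    (ha : act u (-q) (-p) x ≤ a) (hab : a < b) (hbc : b < c) (hcd : c < d)
    (hd : d ≤ act u q p (act u q p x)) {N : ℕ} (hN : (N : ℤ) ≤ q' + q') :
    crossRatio (act u N 0 a) (act u N 0 b) (act u N 0 c) (act u N 0 d) ≤
      orbitBound S B Λ δ ^ 2 * crossRatio a b c d := by
  have h1 := one_le_orbitBound (S := S) (δ := δ) hB hΛ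
  have hcr := crossRatio_pos hab hbc hcd
  rcases le_total (N : ℤ) q' with hNq | hNq
  · refine (hD.crossRatio_act_le hB hΛ hδ h ha hab hbc hcd hd hNq).trans ?_
    gcongr
    exact le_self_pow₀ h1 two_ne_zero
  · obtain ⟨M, hM⟩ : ∃ M : ℕ, (M : ℤ) = q' := ⟨q'.toNat, Int.toNat_of_nonneg
      (by have := h.q_pos; have := h.q_le; omega)⟩
    obtain ⟨n, rfl⟩ : ∃ n, N = n + M := ⟨N - M, by omega⟩
    have e : ∀ y, act u (n + M : ℕ) 0 y = act u n 0 (act u M 0 y) := fun y => by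
      rw [act_act]; push_cast; rfl
    simp only [e]
    have hm := act_strictMono u M 0
    refine (hD.crossRatio_act_le hB hΛ hδ h (x := act u M 0 x) ?_ (hm hab) (hm hbc) (hm hcd) ?_
      (by push_cast at hN; omega)).trans ?_
    · rw [act_comm]; exact hm.monotone ha
    · rw [act_comm u q p M 0, act_comm u q p M 0]; exact hm.monotone hd
    · rw [sq, mul_assoc]
      gcongr
      exact hD.crossRatio_act_le hB hΛ hδ h ha hab hbc hcd hd hM.le

/-! ### Cross-ratios and ratios of neighbouring lengths -/

theorem mul_le_of_le_crossRatio {a b c d η : ℝ} (hab : a < b) (hbc : b < c) (hcd : c < d)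
    (hη : 0 ≤ η) (h : η ≤ crossRatio a b c d) : η * (c - b) ≤ b - a ∧ η * (c - b) ≤ d - c := by
  have h1 := sub_pos.2 hab
  have h2 := sub_pos.2 hbc
  have h3 := sub_pos.2 hcd
  have h4 : 0 < c - a := by linarith
  have h5 : 0 < d - b := by linarith
  rw [crossRatio, le_div_iff₀ (by positivity)] at h
  constructor
  · refine le_of_mul_le_mul_right ?_ h5
    calc η * (c - b) * (d - b) ≤ η * (c - a) * (d - b) := by gcongr
      _ ≤ (b - a) * (d - c) := by linarith
      _ ≤ (b - a) * (d - b) := by gcongr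
  · refine le_of_mul_le_mul_right ?_ h4
    calc η * (c - b) * (c - a) ≤ η * (d - b) * (c - a) := by gcongr
      _ ≤ (b - a) * (d - c) := by linarith
      _ ≤ (c - a) * (d - c) := by gcongr
      _ = _ := mul_comm _ _

theorem one_div_le_crossRatio {a b c d K : ℝ} (hab : a < b) (hbc : b < c) (hcd : c < d)
    (h1 : c - b ≤ K * (b - a)) (h2 : c - b ≤ K * (d - c)) :
    1 / (1 + K) ^ 2 ≤ crossRatio a b c d := by
  have p1 := sub_pos.2 hab
  have p2 := sub_pos.2 hbc
  have p3 := sub_pos.2 hcd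
  have hK : 0 < K := pos_of_mul_pos_left (p2.trans_le h1) p1.le
  have h4 : 0 < c - a := by linarith
  have h5 : 0 < d - b := by linarith
  rw [crossRatio, div_le_div_iff₀ (by positivity) (by positivity)]
  have h6 : c - a ≤ (1 + K) * (b - a) := by linarith
  have h7 : d - b ≤ (1 + K) * (d - c) := by linarith
  calc 1 * ((c - a) * (d - b)) ≤ ((1 + K) * (b - a)) * ((1 + K) * (d - c)) := by
        rw [one_mul]; gcongr
    _ = _ := by ring

theorem crossRatio_le_div {a b c d : ℝ} (hab : a < b) (hbc : b < c) (hcd : c < d) :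
    crossRatio a b c d ≤ (b - a) / (c - b) := by
  have p1 := sub_pos.2 hab
  have p2 := sub_pos.2 hbc
  have p3 := sub_pos.2 hcd
  have h4 : 0 < c - a := by linarith
  have h5 : 0 < d - b := by linarith
  rw [crossRatio, div_le_div_iff₀ (by positivity) p2, mul_assoc]
  have : (d - c) * (c - b) ≤ (c - a) * (d - b) := by
    rw [mul_comm]; gcongr
  gcongr

theorem div_le_crossRatio {a b c d C : ℝ} (hab : a < b) (hbc : b < c) (hcd : c < d)
    (h1 : b - a ≤ C * (c - b)) (h2 : c - b ≤ C * (d - c)) :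
    b - a ≤ (1 + C) ^ 2 * crossRatio a b c d * (c - b) := by
  have p1 := sub_pos.2 hab
  have p2 := sub_pos.2 hbc
  have p3 := sub_pos.2 hcd
  have h4 : 0 < c - a := by linarith
  have h5 : 0 < d - b := by linarith
  have h6 : c - a ≤ (1 + C) * (c - b) := by linarith
  have h7 : d - b ≤ (1 + C) * (d - c) := by linarith
  have e : (1 + C) ^ 2 * crossRatio a b c d * (c - b) =
      (b - a) * (((1 + C) * (c - b)) * ((1 + C) * (d - c))) / ((c - a) * (d - b)) := by
    rw [crossRatio]; field_simp
  rw [e, le_div_iff₀ (by positivity)]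
  have h8 : 0 ≤ (1 + C) * (c - b) := h4.le.trans h6
  gcongr

theorem crossRatio_act (u : CircleDeg1Liftˣ) (k m : ℤ) (a b c d : ℝ) :
    crossRatio (act u k m a) (act u k m b) (act u k m c) (act u k m d) =
      crossRatio (act u k 0 a) (act u k 0 b) (act u k 0 c) (act u k 0 d) := by
  simp only [crossRatio, act_eq_sub u k m, sub_sub_sub_cancel_right]

/-! ### Real bounds -/

/-- The bound for the ratio of the lengths of adjacent fundamental arcs. -/
def adjacentBound (R : ℝ) : ℝ := (2 + 4 * R) ^ 2 * R ^ 2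

theorem one_le_adjacentBound {R : ℝ} (hR : 1 ≤ R) : 1 ≤ adjacentBound R :=
  one_le_mul_of_one_le_of_one_le (one_le_pow₀ (by linarith)) (one_le_pow₀ hR)

section

variable {u : CircleDeg1Liftˣ} {S : Finset ℝ} {B Λ δ : ℝ} {q p q' p' : ℤ}

/-- Lower bounds on cross-ratios pull back along orbits, so it suffices to find one where each orbit
passes: near the point z at which the arc [z, Gz] is shortest. In `adjacentBound`, (2 + 4R)² is the
loss near z and R² that of at most 2q' iterates. -/
theorem HasDistortionBounds.adjacent_le (hD : HasDistortionBounds u S B Λ δ) (hB : 1 ≤ B)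
    (hΛ : 0 < Λ) (hδ : 0 < δ) (h : IsReturnPair u q p q' p') (x : ℝ) :
    act u q p x - x ≤ adjacentBound (orbitBound S B Λ δ) * (x - act u (-q) (-p) x) ∧
    act u q p x - x ≤ adjacentBound (orbitBound S B Λ δ) *
      (act u q p (act u q p x) - act u q p x) := by
  set R := orbitBound S B Λ δ with hR
  have hR1 : 1 ≤ R := one_le_orbitBound hB hΛ
  have hq := h.q_pos
  have hqq := h.q_le
  obtain ⟨z, hz⟩ := exists_le_of_continuous_of_forall_add_int (g := fun x => act u q p x - x)
    ((act_continuous u q p).sub continuous_id) (fun x m => by rw [act_add_int]; ring)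
  set m := act u q p z - z with hm
  have hmp : 0 < m := sub_pos.2 (h.lt_act z)
  have hzz : m ≤ z - act u (-q) (-p) z := by simpa using hz (act u (-q) (-p) z)
  set y := act u (-q) (-p) z with hy
  have hGy : act u q p y = z := IsReturnPair.act_act_neg u q p z
  have h1 : z - y ≤ 4 * R * m := by
    have e1 : 1 / (1 + 1) ^ 2 ≤ crossRatio y z (act u q p z) (act u q p (act u q p z)) :=
      one_div_le_crossRatio (h.act_neg_lt z) (h.lt_act z) (h.lt_act _) (by rw [one_mul]; exact hzz)
        (by rw [one_mul]; exact hz _)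
    obtain ⟨N, hN⟩ : ∃ N : ℕ, (N : ℤ) = q := ⟨q.toNat, Int.toNat_of_nonneg hq.le⟩
    -- G itself carries the quadruple around [y, z] to the one around the shortest arc [z, Gz];
    -- pulling back by it bounds the length of [y, z] by 4Rm.
    have e2 := hD.crossRatio_act_le hB hΛ hδ h le_rfl (h.act_neg_lt y) (h.lt_act y)
      (h.lt_act _) le_rfl (hN.trans_le hqq)
    rw [hN, ← crossRatio_act u q p, IsReturnPair.act_act_neg, hGy] at e2
    have e3 : 1 / (4 * R) ≤ crossRatio (act u (-q) (-p) y) y z (act u q p z) := by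
      rw [div_le_iff₀ (by positivity)]
      rw [← hR] at e2
      linarith
    have e4 := (mul_le_of_le_crossRatio (h.act_neg_lt y) (h.act_neg_lt z) (h.lt_act z)
      (by positivity) e3).2
    rw [← hm, div_mul_eq_mul_div, one_mul, div_le_iff₀ (by positivity)] at e4
    linarith
  obtain ⟨i, j, hi0, hi, hw⟩ := h.exists_act_mem_Icc x z
  set w := act u i j x with hwdef
  have h2 : act u q p w - w ≤ (1 + 4 * R) * m := by
    have e1 : act u q p w ≤ act u q p z := (act_strictMono u q p).monotone hw.2
    have e2 : y ≤ w := hw.1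
    linarith
  have h3 : 1 / (1 + (1 + 4 * R)) ^ 2 ≤ crossRatio (act u (-q) (-p) w) w (act u q p w)
      (act u q p (act u q p w)) := by
    have e1 : m ≤ w - act u (-q) (-p) w := by simpa using hz (act u (-q) (-p) w)
    have e2 : m ≤ act u q p (act u q p w) - act u q p w := hz _
    refine one_div_le_crossRatio (h.act_neg_lt w) (h.lt_act w) (h.lt_act _)
      (h2.trans ?_) (h2.trans ?_) <;> gcongr
  obtain ⟨N, hN⟩ : ∃ N : ℕ, (N : ℤ) = i := ⟨i.toNat, Int.toNat_of_nonneg hi0⟩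
  have h4 := hD.crossRatio_act_le_sq hB hΛ hδ h le_rfl (h.act_neg_lt x) (h.lt_act x)
      (h.lt_act _) le_rfl (N := N) (by omega)
  rw [hN, ← crossRatio_act u i j, act_comm u i j q p, act_comm u i j q p, act_comm u i j q p,
    act_comm u i j (-q) (-p), ← hwdef, ← hR] at h4
  have h5 : 1 / adjacentBound R ≤ crossRatio (act u (-q) (-p) x) x (act u q p x)
      (act u q p (act u q p x)) := by
    have e := h3.trans h4
    rw [adjacentBound, div_le_iff₀ (by positivity)]
    rw [div_le_iff₀ (by positivity)] at e
    linarith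
  have hA : 0 < adjacentBound R := by linarith [one_le_adjacentBound hR1]
  have h6 := mul_le_of_le_crossRatio (h.act_neg_lt x) (h.lt_act x) (h.lt_act _)
    (by positivity) h5
  rw [div_mul_eq_mul_div, one_mul, div_le_iff₀ hA, div_le_iff₀ hA] at h6
  exact ⟨by linarith [h6.1], by linarith [h6.2]⟩

variable {C : ℝ}

/-- If H moved c by less than tD/2, where D is the length of [c, Gc], the H-image of [c - tD, c]
would also be shorter than needed: flatness at the first iterate and bounded distortion afterwards
give at most tD/2. Then H would move c - tD to the right. -/
theorem HasDistortionBounds.mul_le_return_of_flat (hD : HasDistortionBounds u S B Λ δ) (hB : 1 ≤ B)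
    (hΛ : 0 < Λ) (hδ : 0 < δ) (h : IsReturnPair u q p q' p') (hC : 1 ≤ C)
    (hadj : ∀ x, act u q p x - x ≤ C * (x - act u (-q) (-p) x) ∧
      act u q p x - x ≤ C * (act u q p (act u q p x) - act u q p x))
    {c t κ : ℝ} (hκ : κ * (2 * (1 + C) ^ 3 * orbitBound S B Λ δ) ≤ 1) (ht : 0 < t) (htC : t * C ≤ 1)
    (hκp : 0 < κ)
    (hflat : ∀ D, 0 < D → D ≤ 1 → u c - u (c - t * D) ≤ κ * t * (u (c + D) - u c)) :
    t * (act u q p c - c) ≤ 2 * (c - act u q' p' c) := by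
  by_contra hn
  rw [not_le] at hn
  set R := orbitBound S B Λ δ with hR
  have hR1 : 1 ≤ R := one_le_orbitBound hB hΛ
  have hadj' : ∀ x, x - act u (-q) (-p) x ≤ C * (act u q p x - x) := fun x => by
    simpa using (hadj (act u (-q) (-p) x)).2
  set D := act u q p c - c with hDdef
  have hDp : 0 < D := sub_pos.2 (h.lt_act c)
  have hD1 : D ≤ 1 := by linarith [h.act_lt_add_one c]
  set x := c - t * D with hx
  have htD : 0 < t * D := by positivity
  have hxc : x < c := by linarith
  have hxc1 : act u (-q) (-p) c ≤ x := by
    have h1 := (hadj c).1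
    have h2 : t * D ≤ t * (C * (c - act u (-q) (-p) c)) := by gcongr
    have h3 : t * (C * (c - act u (-q) (-p) c)) ≤ 1 * (c - act u (-q) (-p) c) := by
      rw [← mul_assoc]
      have := sub_pos.2 (h.act_neg_lt c)
      gcongr
    linarith
  have m1 := act_strictMono u 1 0
  -- The first iterate is left to flatness; distortion is bounded only along the remaining q' - 1.
  obtain ⟨N, hN⟩ : ∃ N : ℕ, (N : ℤ) = q' - 1 := ⟨(q' - 1).toNat, Int.toNat_of_nonneg
    (by have := h.q_pos; have := h.q_le; omega)⟩
  have h1 := hD.crossRatio_act_le hB hΛ hδ h (x := act u 1 0 c) (a := act u 1 0 x)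
    (b := act u 1 0 c) (c := act u 1 0 (act u q p c)) (d := act u 1 0 (act u q p (act u q p c)))
    (by rw [act_comm u (-q) (-p)]; exact m1.monotone hxc1) (m1 hxc) (m1 (h.lt_act c))
    (m1 (h.lt_act _)) (by rw [act_comm u 1 0 q p (act u q p c), act_comm u 1 0 q p c]) (N := N)
    (by omega)
  have eN : ∀ y, act u N 0 (act u 1 0 y) = act u q' 0 y := fun y => by
    rw [act_act, hN, sub_add_cancel, add_zero]
  simp only [eN] at h1
  rw [← crossRatio_act u q' p'] at h1
  set b := act u q' p' c with hb
  have e1 : act u q' p' (act u q p c) = act u q p b := act_comm u _ _ _ _ _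
  have e2 : act u q' p' (act u q p (act u q p c)) = act u q p (act u q p b) := by
    rw [act_comm, e1]
  rw [e1, e2] at h1
  have h2 : crossRatio (act u 1 0 x) (act u 1 0 c) (act u 1 0 (act u q p c))
      (act u 1 0 (act u q p (act u q p c))) ≤ κ * t := by
    refine (crossRatio_le_div (m1 hxc) (m1 (h.lt_act c)) (m1 (h.lt_act _))).trans ?_
    rw [div_le_iff₀ (sub_pos.2 (m1 (h.lt_act c)))]
    have := hflat D hDp hD1
    simp only [act_one_zero]
    rwa [hDdef, add_sub_cancel, ← hDdef, ← hx] at this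
  have hxb : act u q' p' x < b := act_strictMono u q' p' hxc
  have h3 : b - act u q' p' x ≤ C * (act u q p b - b) := by
    refine le_trans ?_ (hadj' b)
    have := (act_strictMono u q' p').monotone hxc1
    rw [act_comm] at this
    linarith
  have h4 := div_le_crossRatio hxb (h.lt_act b) (h.lt_act _) h3 (hadj b).2
  have hbc : b < c := h.act'_lt c
  have h5 : act u q p b - b ≤ (1 + C) * D := by
    have e3 := (act_strictMono u q p) hbc
    have e4 := h.act_neg_lt_act' c
    have e5 := hadj' c
    linarith
  have hMp : 0 < act u q p b - b := sub_pos.2 (h.lt_act b)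
  have h6 : b - act u q' p' x ≤ t * D / 2 := by
    calc b - act u q' p' x ≤ _ := h4
      _ ≤ (1 + C) ^ 2 * (R * (κ * t)) * ((1 + C) * D) := by
        gcongr
        exact h1.trans (by gcongr)
      _ = κ * (2 * (1 + C) ^ 3 * R) * (t * D / 2) := by ring
      _ ≤ 1 * (t * D / 2) := by gcongr
      _ = _ := one_mul _
  have h7 := h.act'_lt x
  linarith

/-- With b = Hc, the bound at c and comparability of adjacent short arcs bound from below the
cross-ratio of Hb, b, Gb, G²b. The q' - j iterates leading from f^j(c) to b pull this back to
f^j(c). -/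
theorem HasDistortionBounds.act_sub_le_of_mul_le_return (hD : HasDistortionBounds u S B Λ δ)
    (hB : 1 ≤ B) (hΛ : 0 < Λ) (hδ : 0 < δ) (h : IsReturnPair u q p q' p') (hC : 1 ≤ C)
    (hadj : ∀ x, act u q p x - x ≤ C * (x - act u (-q) (-p) x) ∧
      act u q p x - x ≤ C * (act u q p (act u q p x) - act u q p x))
    (hadj' : ∀ x, x - act u q' p' x ≤ C * (act u q' p' x - act u q' p' (act u q' p' x)))
    {c t : ℝ} (ht : 0 < t) (hc : t * (act u q p c - c) ≤ 2 * (c - act u q' p' c)) {j : ℤ}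
    (hj0 : 0 ≤ j) (hj : j ≤ q') :
    act u q p (act u j 0 c) - act u j 0 c ≤
      orbitBound S B Λ δ * (1 + (2 * C * (1 + C) / t + C)) ^ 2 *
        (act u j 0 c - act u q' p' (act u j 0 c)) := by
  set R := orbitBound S B Λ δ with hR
  have hR1 : 1 ≤ R := one_le_orbitBound hB hΛ
  set D := act u q p c - c with hDdef
  have hDp : 0 < D := sub_pos.2 (h.lt_act c)
  set K := 2 * C * (1 + C) / t + C with hK
  have hKp : 0 < K := by positivity
  set b := act u q' p' c with hb
  have hbc : b < c := h.act'_lt c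
  have h5 : act u q p b - b ≤ (1 + C) * D := by
    have e3 := (act_strictMono u q p) hbc
    have e4 := h.act_neg_lt_act' c
    have e5 : c - act u (-q) (-p) c ≤ C * (act u q p c - c) := by
      simpa using (hadj (act u (-q) (-p) c)).2
    linarith
  have h6 : 1 / (1 + K) ^ 2 ≤
      crossRatio (act u q' p' b) b (act u q p b) (act u q p (act u q p b)) := by
    refine one_div_le_crossRatio (h.act'_lt b) (h.lt_act b) (h.lt_act _) ?_ ?_
    · have e1 : t * D ≤ 2 * C * (b - act u q' p' b) := by linarith [hadj' c]
      have e2 : 0 < b - act u q' p' b := sub_pos.2 (h.act'_lt b)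
      calc act u q p b - b ≤ (1 + C) * D := h5
        _ = (1 + C) / t * (t * D) := by field_simp
        _ ≤ (1 + C) / t * (2 * C * (b - act u q' p' b)) := by gcongr
        _ = (2 * C * (1 + C) / t) * (b - act u q' p' b) := by ring
        _ ≤ K * (b - act u q' p' b) := by
          gcongr
          rw [hK]
          linarith
    · have e2 := sub_pos.2 (h.lt_act (act u q p b))
      refine (hadj b).2.trans ?_
      gcongr
      rw [hK]
      have : 0 ≤ 2 * C * (1 + C) / t := by positivity
      linarith
  set y := act u j 0 c with hy
  obtain ⟨N, hN⟩ : ∃ N : ℕ, (N : ℤ) = q' - j := ⟨(q' - j).toNat, Int.toNat_of_nonneg (by omega)⟩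
  have h7 := hD.crossRatio_act_le hB hΛ hδ h (h.act_neg_lt_act' y).le (h.act'_lt y) (h.lt_act y)
    (h.lt_act _) le_rfl (N := N) (by omega)
  have eN : act u N p' y = b := by
    rw [hy, act_act, hN, sub_add_cancel, add_zero]
  rw [← crossRatio_act u N p', act_comm u N p' q p, act_comm u N p' q p, act_comm u N p' q p,
    act_comm u N p' q' p', eN, ← hR] at h7
  have h8 : 1 / (R * (1 + K) ^ 2) ≤ crossRatio (act u q' p' y) y (act u q p y)
      (act u q p (act u q p y)) := by
    have e := h6.trans h7
    rw [div_le_iff₀ (by positivity)] at e ⊢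
    linarith
  have h9 := (mul_le_of_le_crossRatio (h.act'_lt y) (h.lt_act y) (h.lt_act _)
    (by positivity) h8).1
  rw [div_mul_eq_mul_div, one_mul, div_le_iff₀ (by positivity)] at h9
  linarith

end

/-! ### Reflection and closest returns on either side -/

/-- Conjugation of a lift by `x ↦ -x`. -/
def reflectHom : CircleDeg1Lift →* CircleDeg1Lift where
  toFun f := ⟨⟨fun x => -f (-x), fun _ _ h => neg_le_neg (f.monotone (neg_le_neg h))⟩, fun x => by
    have := f.map_add_one (-(x + 1))
    simp only [neg_add_rev, neg_add_cancel_comm] at this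
    simp only [neg_add_rev]
    rw [this]
    ring⟩
  map_one' := by ext x; simp
  map_mul' f g := by
    ext x
    change -f (g (-x)) = -f (-(-g (-x)))
    rw [neg_neg]

theorem reflectHom_apply (f : CircleDeg1Lift) (x : ℝ) : reflectHom f x = -f (-x) := rfl

/-- Conjugation of an invertible lift by `x ↦ -x`. -/
def reflect (u : CircleDeg1Liftˣ) : CircleDeg1Liftˣ := Units.map reflectHom u

theorem reflect_apply (u : CircleDeg1Liftˣ) (x : ℝ) : reflect u x = -u (-x) := rfl

theorem act_reflect (u : CircleDeg1Liftˣ) (k m : ℤ) (x : ℝ) :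
    act (reflect u) k m x = -act u k (-m) (-x) := by
  have : reflect u ^ k = reflect (u ^ k) := by simp [reflect]
  simp only [act, this, reflect_apply]
  push_cast
  ring

theorem translationNumber_reflect (u : CircleDeg1Liftˣ) :
    (reflect u : CircleDeg1Lift).translationNumber = -(u : CircleDeg1Lift).translationNumber := by
  refine CircleDeg1Lift.translationNumber_eq_of_tendsto₀ _ ?_
  have h := (u : CircleDeg1Lift).tendsto_translation_number₀.neg
  refine h.congr fun n => ?_
  have e : (reflect u : CircleDeg1Lift) = reflectHom u := rfl
  rw [← CircleDeg1Lift.coe_pow, e, ← map_pow, reflectHom_apply, neg_zero, neg_div]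

theorem HasDistortionBounds.reflect {u : CircleDeg1Liftˣ} {S : Finset ℝ} {B Λ δ : ℝ}
    (h : HasDistortionBounds u S B Λ δ) :
    HasDistortionBounds (reflect u) (S.image Neg.neg) B Λ δ := by
  have e : ∀ a b c d : ℝ, crossRatio (-d) (-c) (-b) (-a) = crossRatio a b c d := by
    intro a b c d
    simp only [crossRatio]
    ring
  refine ⟨?_, ?_, ?_⟩
  · intro a b c d hab hbc hcd had
    have := h.crossRatio_le (-d) (-c) (-b) (-a) (by linarith) (by linarith) (by linarith)
      (by linarith)
    simp only [reflect_apply]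
    rw [e] at this
    rwa [← e, neg_neg, neg_neg, neg_neg, neg_neg]
  · intro a b c d hab hbc hcd had hS
    have := h.crossRatio_le_exp (-d) (-c) (-b) (-a) (by linarith) (by linarith) (by linarith)
      (by linarith) (by
        intro s hs m hm
        refine hS (-s) (Finset.mem_image_of_mem _ hs) (-m) ?_
        push_cast
        exact ⟨by linarith [hm.2], by linarith [hm.1]⟩)
    simp only [reflect_apply]
    rw [e, show -a - -d = d - a by ring] at this
    rwa [← e, neg_neg, neg_neg, neg_neg, neg_neg]
  · intro p hp κ hκ
    obtain ⟨s, hs, rfl⟩ := Finset.mem_image.1 hp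
    obtain ⟨t₀, ht₀, hf⟩ := h.flat s hs κ hκ
    refine ⟨t₀, ht₀, fun t ht htt D hD hD1 => ?_⟩
    have := hf t ht htt D hD hD1
    simp only [reflect_apply]
    rw [show -(-s - t * D) = s + t * D by ring, show -(-s + D) = s - D by ring, neg_neg,
      show -(-s + t * D) = s - t * D by ring, show -(-s - D) = s + D by ring]
    exact ⟨by linarith [this.2], by linarith [this.1]⟩

theorem orbitBound_image_neg (S : Finset ℝ) (B Λ δ : ℝ) :
    orbitBound (S.image Neg.neg) B Λ δ = orbitBound S B Λ δ := by
  unfold orbitBound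
  rw [Finset.card_image_of_injective _ neg_injective]

/-- `q` and `q'` are consecutive closest return times, `p` and `p'` are the corresponding numbers
of turns. -/
structure IsClosestReturn (u : CircleDeg1Liftˣ) (q p q' p' : ℤ) : Prop where
  irrational : Irrational (u : CircleDeg1Lift).translationNumber
  q_pos : 0 < q
  q_le : q ≤ q'
  abs_lt_one : |q * (u : CircleDeg1Lift).translationNumber - p| < 1
  mul_neg : (q * (u : CircleDeg1Lift).translationNumber - p) *
    (q' * (u : CircleDeg1Lift).translationNumber - p') < 0
  abs_lt : |q' * (u : CircleDeg1Lift).translationNumber - p'| <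
    |q * (u : CircleDeg1Lift).translationNumber - p|
  best : ∀ k m : ℤ, k ≠ 0 → |k| < q' → |q * (u : CircleDeg1Lift).translationNumber - p| ≤
    |k * (u : CircleDeg1Lift).translationNumber - m|

theorem IsClosestReturn.isReturnPair_or {u : CircleDeg1Liftˣ} {q p q' p' : ℤ}
    (h : IsClosestReturn u q p q' p') :
    IsReturnPair u q p q' p' ∨ IsReturnPair (reflect u) q (-p) q' (-p') := by
  rcases lt_or_ge 0 (q * (u : CircleDeg1Lift).translationNumber - p) with h0 | h0
  · left
    have h1 := h.abs_lt_one
    have h2 : q' * (u : CircleDeg1Lift).translationNumber - p' < 0 :=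
      neg_of_mul_neg_right h.mul_neg h0.le
    have h3 := h.abs_lt
    rw [abs_of_pos h0] at h1 h3
    rw [abs_of_neg h2] at h3
    refine ⟨h.irrational, h.q_pos, h.q_le, h0, h1, h2, by linarith, ?_⟩
    intro k m hk hkq
    have := h.best k m hk hkq
    rwa [abs_of_pos h0] at this
  · right
    have h0 : q * (u : CircleDeg1Lift).translationNumber - p < 0 :=
      lt_of_le_of_ne h0 fun h' => by have := h.mul_neg; rw [h', zero_mul] at this; exact this.false
    have h1 := h.abs_lt_one
    have h2 : 0 < q' * (u : CircleDeg1Lift).translationNumber - p' :=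
      pos_of_mul_neg_right h.mul_neg h0.le
    have h3 := h.abs_lt
    rw [abs_of_neg h0] at h1 h3
    rw [abs_of_pos h2] at h3
    refine ⟨?_, h.q_pos, h.q_le, ?_, ?_, ?_, ?_, ?_⟩
    · rw [translationNumber_reflect]; exact h.irrational.neg
    all_goals rw [translationNumber_reflect]; push_cast
    · linarith
    · linarith
    · linarith
    · linarith
    · intro k m hk hkq
      have := h.best k (-m) hk hkq
      rw [abs_of_neg h0, ← abs_neg] at this
      push_cast at this
      have e : k * -(u : CircleDeg1Lift).translationNumber - m =
        -(k * (u : CircleDeg1Lift).translationNumber - -m) := by ring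
      rw [e]
      linarith

/-- The length of the arc from `x` to its image under `act u q p`. -/
def gap (u : CircleDeg1Liftˣ) (q p : ℤ) (x : ℝ) : ℝ := |act u q p x - x|

theorem gap_reflect (u : CircleDeg1Liftˣ) (q p : ℤ) (x : ℝ) :
    gap (reflect u) q (-p) x = gap u q p (-x) := by
  rw [gap, gap, act_reflect, neg_neg, ← abs_neg]
  congr 1
  ring

theorem neg_mem_uIcc {a b s : ℝ} (h : s ∈ uIcc a b) : -s ∈ uIcc (-a) (-b) := by
  rw [mem_uIcc] at h ⊢
  rcases h with h | h
  · exact Or.inr ⟨by linarith, by linarith⟩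
  · exact Or.inl ⟨by linarith, by linarith⟩

section

variable {u : CircleDeg1Liftˣ} {q p q' p' : ℤ}

theorem IsReturnPair.gap_eq (h : IsReturnPair u q p q' p') (x : ℝ) :
    gap u q p x = act u q p x - x := abs_of_pos (sub_pos.2 (h.lt_act x))

theorem IsReturnPair.gap_eq' (h : IsReturnPair u q p q' p') (x : ℝ) :
    gap u q' p' x = x - act u q' p' x := by
  rw [gap, abs_sub_comm]
  exact abs_of_pos (sub_pos.2 (h.act'_lt x))

theorem IsReturnPair.uIcc_eq (h : IsReturnPair u q p q' p') (x : ℝ) :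
    uIcc x (act u q p x) = Icc x (act u q p x) := uIcc_of_le (h.lt_act x).le

variable {S : Finset ℝ} {B Λ δ : ℝ}

theorem HasDistortionBounds.gap_le (hD : HasDistortionBounds u S B Λ δ) (hB : 1 ≤ B)
    (hΛ : 0 < Λ) (hδ : 0 < δ) (h : IsClosestReturn u q p q' p') (x : ℝ) :
    gap u q p x ≤ adjacentBound (orbitBound S B Λ δ) * gap u q p (act u q p x) ∧
    gap u q p (act u q p x) ≤ adjacentBound (orbitBound S B Λ δ) * gap u q p x := by
  have key : ∀ {v : CircleDeg1Liftˣ} {T : Finset ℝ} {r r' : ℤ}, HasDistortionBounds v T B Λ δ →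
      IsReturnPair v q r q' r' → ∀ x,
      gap v q r x ≤ adjacentBound (orbitBound T B Λ δ) * gap v q r (act v q r x) ∧
      gap v q r (act v q r x) ≤ adjacentBound (orbitBound T B Λ δ) * gap v q r x := by
    intro v T r r' hD h x
    rw [h.gap_eq, h.gap_eq]
    have h1 := hD.adjacent_le hB hΛ hδ h x
    have h2 := hD.adjacent_le hB hΛ hδ h (act v q r x)
    rw [IsReturnPair.act_neg_act] at h2
    exact ⟨h1.2, h2.1⟩
  rcases h.isReturnPair_or with h | h
  · exact key hD h x
  · have := key hD.reflect h (-x)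
    rw [orbitBound_image_neg] at this
    simpa only [gap_reflect, act_reflect, neg_neg] using this

theorem HasDistortionBounds.exists_gap_le_of_isReturnPair (hD : HasDistortionBounds u S B Λ δ)
    (hB : 1 ≤ B) (hΛ : 0 < Λ) (hδ : 0 < δ) :
    ∃ K, 1 ≤ K ∧ ∀ q p q' p' : ℤ, IsReturnPair u q p q' p' →
      (∀ x, gap u q p x ≤ adjacentBound (orbitBound S B Λ δ) * gap u q p (act u q p x) ∧
        gap u q p (act u q p x) ≤ adjacentBound (orbitBound S B Λ δ) * gap u q p x) →
      (∀ x, gap u q' p' x ≤ adjacentBound (orbitBound S B Λ δ) * gap u q' p' (act u q' p' x)) →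
      ∀ c ∈ S, ∀ j : ℤ, 0 ≤ j → j ≤ q' →
        gap u q p (act u j 0 c) ≤ K * gap u q' p' (act u j 0 c) := by
  set R := orbitBound S B Λ δ with hR
  have hR1 : 1 ≤ R := one_le_orbitBound hB hΛ
  set C := adjacentBound R with hC
  have hC1 : 1 ≤ C := one_le_adjacentBound hR1
  -- The largest κ allowed by `mul_le_return_of_flat`; finiteness of S then gives one t for all
  -- critical points.
  set κ := 1 / (2 * (1 + C) ^ 3 * R) with hκ
  have hκp : 0 < κ := by positivity
  have ht : ∃ t > 0, t * C ≤ 1 ∧ ∀ c ∈ S, ∀ D, 0 < D → D ≤ 1 →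
      u c - u (c - t * D) ≤ κ * t * (u (c + D) - u c) := by
    have h1 : ∀ᶠ t in 𝓝[>] (0 : ℝ), ∀ c ∈ S, ∀ D, 0 < D → D ≤ 1 →
        u c - u (c - t * D) ≤ κ * t * (u (c + D) - u c) := by
      rw [Filter.eventually_all_finset]
      intro c hc
      obtain ⟨t₀, ht₀, hf⟩ := hD.flat c hc κ hκp
      filter_upwards [Ioo_mem_nhdsGT ht₀] with t ht D hD hD1
      exact (hf t ht.1 ht.2.le D hD hD1).1
    obtain ⟨t, ht, ht'⟩ := (h1.and (Ioo_mem_nhdsGT (show 0 < 1 / C by positivity))).exists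
    refine ⟨t, ht'.1, ?_, ht⟩
    have := ht'.2.le
    rwa [le_div_iff₀ (by positivity)] at this
  obtain ⟨t, htp, htC, hflat⟩ := ht
  refine ⟨R * (1 + (2 * C * (1 + C) / t + C)) ^ 2, ?_, ?_⟩
  · refine one_le_mul_of_one_le_of_one_le hR1 (one_le_pow₀ ?_)
    have : 0 ≤ 2 * C * (1 + C) / t + C := by positivity
    linarith
  · intro q p q' p' h h1 h2 c hc j hj0 hj
    have hadj : ∀ x, act u q p x - x ≤ C * (x - act u (-q) (-p) x) ∧
        act u q p x - x ≤ C * (act u q p (act u q p x) - act u q p x) :=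
      hD.adjacent_le hB hΛ hδ h
    simp only [h.gap_eq'] at h2
    rw [h.gap_eq, h.gap_eq']
    refine hD.act_sub_le_of_mul_le_return hB hΛ hδ h hC1 hadj h2 htp ?_ hj0 hj
    refine hD.mul_le_return_of_flat hB hΛ hδ h hC1 hadj (κ := κ) ?_ htp htC hκp (hflat c hc)
    rw [hκ, one_div, inv_mul_cancel₀ (by positivity)]

/-- The second closest-return hypothesis supplies the comparability of adjacent arcs for (q', p').
-/
theorem HasDistortionBounds.exists_gap_le (hD : HasDistortionBounds u S B Λ δ)
    (hB : 1 ≤ B) (hΛ : 0 < Λ) (hδ : 0 < δ) :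
    ∃ K, 1 ≤ K ∧ ∀ q p q' p' q'' p'' : ℤ, IsClosestReturn u q p q' p' →
      IsClosestReturn u q' p' q'' p'' → ∀ c ∈ S, ∀ j : ℤ, 0 ≤ j → j ≤ q' →
        gap u q p (act u j 0 c) ≤ K * gap u q' p' (act u j 0 c) := by
  obtain ⟨K₁, hK₁, h₁⟩ := hD.exists_gap_le_of_isReturnPair hB hΛ hδ
  obtain ⟨K₂, hK₂, h₂⟩ := hD.reflect.exists_gap_le_of_isReturnPair hB hΛ hδ
  refine ⟨max K₁ K₂, le_max_of_le_left hK₁, ?_⟩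
  intro q p q' p' q'' p'' h h' c hc j hj0 hj
  have hg : 0 ≤ gap u q' p' (act u j 0 c) := abs_nonneg _
  rcases h.isReturnPair_or with hr | hr
  · refine (h₁ q p q' p' hr (hD.gap_le hB hΛ hδ h) (fun x => (hD.gap_le hB hΛ hδ h' x).1) c hc j
      hj0 hj).trans ?_
    gcongr
    exact le_max_left _ _
  · have := h₂ q (-p) q' (-p') hr ?_ ?_ (-c) (Finset.mem_image_of_mem _ hc) j hj0 hj
    · simp only [gap_reflect, act_reflect, neg_neg, neg_zero] at this
      refine this.trans ?_
      gcongr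
      exact le_max_right _ _
    · intro x
      simp only [gap_reflect, act_reflect, neg_neg, orbitBound_image_neg]
      exact hD.gap_le hB hΛ hδ h (-x)
    · intro x
      simp only [gap_reflect, act_reflect, neg_neg, orbitBound_image_neg]
      exact (hD.gap_le hB hΛ hδ h' (-x)).1

/-- An arc meeting [y, Gy] lies between the inverse G-image of y and G²y, that is, in three adjacent
arcs. -/
theorem IsClosestReturn.gap_le_of_mem_uIcc (h : IsClosestReturn u q p q' p') {C : ℝ}
    (hC : ∀ x, gap u q p x ≤ C * gap u q p (act u q p x) ∧
      gap u q p (act u q p x) ≤ C * gap u q p x) {x y s : ℝ}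
    (hx : s ∈ uIcc x (act u q p x)) (hy : s ∈ uIcc y (act u q p y)) :
    gap u q p x ≤ (1 + 2 * C) * gap u q p y := by
  have key : ∀ {v : CircleDeg1Liftˣ} {r r' : ℤ}, IsReturnPair v q r q' r' →
      (∀ x, gap v q r x ≤ C * gap v q r (act v q r x) ∧
      gap v q r (act v q r x) ≤ C * gap v q r x) → ∀ {x y s : ℝ},
    s ∈ uIcc x (act v q r x) → s ∈ uIcc y (act v q r y) →
    gap v q r x ≤ (1 + 2 * C) * gap v q r y := by
    intro v r r' h hC x y s hx hy
    rw [h.uIcc_eq] at hx hy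
    have h1 := (hC y).2
    have h2 := (hC (act v (-q) (-r) y)).1
    rw [IsReturnPair.act_act_neg] at h2
    simp only [h.gap_eq, IsReturnPair.act_act_neg] at *
    have h3 := (act_strictMono v q r).monotone (hx.1.trans hy.2)
    have h4 := (act_strictMono v (-q) (-r)).monotone (hy.1.trans hx.2)
    rw [IsReturnPair.act_neg_act] at h4
    linarith
  rcases h.isReturnPair_or with h | h
  · exact key h hC hx hy
  · have := key h (fun x => by simpa only [gap_reflect, act_reflect, neg_neg] using hC (-x))
      (x := -x) (y := -y) (s := -s)
      (by simpa only [act_reflect, neg_neg] using neg_mem_uIcc hx)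
      (by simpa only [act_reflect, neg_neg] using neg_mem_uIcc hy)
    simpa only [gap_reflect, neg_neg] using this

/-- The arc from y to Hy lies in the long arc from y to its inverse G-image, which reduces matters
to two long arcs that meet. -/
theorem IsClosestReturn.gap_le_gap_of_mem_uIcc (h : IsClosestReturn u q p q' p') {C : ℝ}
    (hC1 : 1 ≤ C) (hC : ∀ x, gap u q p x ≤ C * gap u q p (act u q p x) ∧
      gap u q p (act u q p x) ≤ C * gap u q p x) {x y s : ℝ}
    (hx : s ∈ uIcc x (act u q p x)) (hy : s ∈ uIcc y (act u q' p' y)) :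
    gap u q' p' y ≤ (1 + 2 * C) * gap u q p x ∧
      gap u q p x ≤ (1 + 2 * C) * C * gap u q p y := by
  have key : uIcc y (act u q' p' y) ⊆ uIcc y (act u (-q) (-p) y) →
      gap u q' p' y ≤ gap u q p (act u (-q) (-p) y) →
      gap u q' p' y ≤ (1 + 2 * C) * gap u q p x ∧
      gap u q p x ≤ (1 + 2 * C) * C * gap u q p y := by
    intro hsub hle
    have h1 := hsub hy
    rw [uIcc_comm] at h1
    have h2 : s ∈ uIcc (act u (-q) (-p) y) (act u q p (act u (-q) (-p) y)) := by
      rwa [IsReturnPair.act_act_neg]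
    have h3 := h.gap_le_of_mem_uIcc hC h2 hx
    have h4 := h.gap_le_of_mem_uIcc hC hx h2
    have h5 := (hC (act u (-q) (-p) y)).1
    rw [IsReturnPair.act_act_neg] at h5
    refine ⟨hle.trans h3, h4.trans ?_⟩
    rw [mul_assoc]
    gcongr
  rcases h.isReturnPair_or with hr | hr
  · refine key ?_ ?_
    · rw [uIcc_of_ge (hr.act'_lt y).le, uIcc_of_ge (hr.act_neg_lt y).le]
      exact Icc_subset_Icc_left (hr.act_neg_lt_act' y).le
    · rw [hr.gap_eq, hr.gap_eq', IsReturnPair.act_act_neg]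
      linarith [hr.act_neg_lt_act' y]
  · have h1 := hr.act'_lt (-y)
    have h2 := hr.act_neg_lt (-y)
    have h3 := hr.act_neg_lt_act' (-y)
    simp only [act_reflect, neg_neg, neg_lt_neg_iff] at h1 h2 h3
    refine key ?_ ?_
    · rw [uIcc_of_le h1.le, uIcc_of_le h2.le]
      exact Icc_subset_Icc_right h3.le
    · rw [gap, gap, IsReturnPair.act_act_neg, abs_of_pos (by linarith), abs_of_neg (by linarith)]
      linarith

end

/-! ### Continued fractions and best approximation -/

/-- The orbit of `ρ` under the Gauss map. -/
def gaussOrbit (ρ : ℝ) : ℕ → ℝ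
  | 0 => ρ
  | n + 1 => Int.fract (gaussOrbit ρ n)⁻¹

/-- The numerators of the convergents of `ρ`. -/
def returnTurns (ρ : ℝ) : ℕ → ℤ
  | 0 => 0
  | 1 => 1
  | n + 2 => partialQuotient ρ (n + 1) * returnTurns ρ (n + 1) + returnTurns ρ n

section

variable {ρ : ℝ} (hirr : Irrational ρ) (h0 : 0 < ρ) (h1 : ρ < 1)
include hirr

theorem irrational_gaussOrbit (n : ℕ) : Irrational (gaussOrbit ρ n) := by
  induction n with
  | zero => exact hirr
  | succ n ih =>
    rw [gaussOrbit, ← Int.self_sub_floor]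
    exact (irrational_inv_iff.2 ih).sub_intCast _

include h0 h1

theorem gaussOrbit_mem_Ioo (n : ℕ) : gaussOrbit ρ n ∈ Ioo (0 : ℝ) 1 := by
  cases n with
  | zero => exact ⟨h0, h1⟩
  | succ n =>
    refine ⟨lt_of_le_of_ne (Int.fract_nonneg _) fun h => ?_, Int.fract_lt_one _⟩
    exact (irrational_gaussOrbit hirr (n + 1)).ne_zero h.symm

theorem stream_eq_gaussOrbit (n : ℕ) : ∃ b : ℤ,
    GenContFract.IntFractPair.stream ρ n = some ⟨b, gaussOrbit ρ n⟩ := by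
  induction n with
  | zero =>
    refine ⟨⌊ρ⌋, ?_⟩
    rw [GenContFract.IntFractPair.stream_zero, GenContFract.IntFractPair.of, gaussOrbit,
      Int.fract_eq_self.2 ⟨h0.le, h1⟩]
  | succ n ih =>
    obtain ⟨b, hb⟩ := ih
    exact ⟨⌊(gaussOrbit ρ n)⁻¹⌋, GenContFract.IntFractPair.stream_succ_of_some hb
      (gaussOrbit_mem_Ioo hirr h0 h1 n).1.ne'⟩

theorem partialQuotient_eq_floor (n : ℕ) :
    (partialQuotient ρ n : ℤ) = ⌊(gaussOrbit ρ n)⁻¹⌋ := by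
  have hr := gaussOrbit_mem_Ioo hirr h0 h1 n
  obtain ⟨b, hb⟩ := stream_eq_gaussOrbit hirr h0 h1 n
  have hs := GenContFract.get?_of_eq_some_of_get?_intFractPair_stream_fr_ne_zero hb hr.1.ne'
  have hp := GenContFract.partDen_eq_s_b hs
  rw [partialQuotient, hp]
  simp only [Option.elim_some, GenContFract.IntFractPair.of]
  have hf : (0 : ℝ) ≤ (⌊(gaussOrbit ρ n)⁻¹⌋ : ℤ) := by
    exact_mod_cast Int.floor_nonneg.2 (inv_nonneg.2 hr.1.le)
  rw [Int.natCast_floor_eq_floor hf, Int.floor_intCast]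

theorem one_le_partialQuotient (n : ℕ) : 1 ≤ partialQuotient ρ n := by
  have hr := gaussOrbit_mem_Ioo hirr h0 h1 n
  have h2 : 1 ≤ ⌊(gaussOrbit ρ n)⁻¹⌋ := Int.le_floor.2 (by
    rw [Int.cast_one]; exact (one_lt_inv₀ hr.1).2 hr.2 |>.le)
  rw [← partialQuotient_eq_floor hirr h0 h1] at h2
  exact_mod_cast h2

theorem returnTime_pos_and_le (n : ℕ) :
    0 < returnTime ρ n ∧ returnTime ρ n ≤ returnTime ρ (n + 1) := by
  induction n with
  | zero => exact ⟨one_pos, one_le_partialQuotient hirr h0 h1 0⟩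
  | succ n ih =>
    refine ⟨ih.1.trans_le ih.2, ?_⟩
    rw [returnTime]
    have := one_le_partialQuotient hirr h0 h1 (n + 1)
    nlinarith

/-- Alternating signs and strict decrease of the approximation errors both follow, since the Gauss
orbit stays in (0, 1). -/
theorem returnTime_sub_returnTurns_succ (n : ℕ) :
    returnTime ρ (n + 1) * ρ - returnTurns ρ (n + 1) =
      -gaussOrbit ρ (n + 1) * (returnTime ρ n * ρ - returnTurns ρ n) := by
  have ha : ∀ n, (partialQuotient ρ n : ℝ) = (gaussOrbit ρ n)⁻¹ - gaussOrbit ρ (n + 1) := by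
    intro n
    rw [gaussOrbit, Int.self_sub_fract, ← partialQuotient_eq_floor hirr h0 h1]
    simp
  have hne : ∀ n, gaussOrbit ρ n ≠ 0 := fun n => (gaussOrbit_mem_Ioo hirr h0 h1 n).1.ne'
  induction n with
  | zero =>
    have := h0.ne'
    simp only [returnTime, returnTurns, ha 0]
    simp only [gaussOrbit]
    push_cast
    field_simp
    ring
  | succ n ih =>
    have e : returnTime ρ (n + 2) * ρ - returnTurns ρ (n + 2) =
        partialQuotient ρ (n + 1) * (returnTime ρ (n + 1) * ρ - returnTurns ρ (n + 1)) +
          (returnTime ρ n * ρ - returnTurns ρ n) := by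
      rw [returnTime, returnTurns]
      push_cast
      ring
    have := hne (n + 1)
    rw [e, ih, ha]
    field_simp
    ring

theorem returnTime_sub_returnTurns_ne_zero (n : ℕ) :
    returnTime ρ n * ρ - returnTurns ρ n ≠ 0 := by
  induction n with
  | zero => simpa [returnTime, returnTurns] using h0.ne'
  | succ n ih =>
    rw [returnTime_sub_returnTurns_succ hirr h0 h1]
    exact mul_ne_zero (neg_ne_zero.2 (gaussOrbit_mem_Ioo hirr h0 h1 _).1.ne') ih

theorem abs_returnTime_sub_returnTurns_succ_lt (n : ℕ) :
    |returnTime ρ (n + 1) * ρ - returnTurns ρ (n + 1)| < |returnTime ρ n * ρ - returnTurns ρ n| := by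
  have hr := gaussOrbit_mem_Ioo hirr h0 h1 (n + 1)
  have := abs_pos.2 (returnTime_sub_returnTurns_ne_zero hirr h0 h1 n)
  rw [returnTime_sub_returnTurns_succ hirr h0 h1, abs_mul, abs_neg, abs_of_pos hr.1]
  exact mul_lt_of_lt_one_left this hr.2

theorem abs_returnTime_sub_returnTurns_lt_one (n : ℕ) :
    |returnTime ρ n * ρ - returnTurns ρ n| < 1 := by
  induction n with
  | zero => simpa [returnTime, returnTurns, abs_of_pos h0] using h1
  | succ n ih => exact (abs_returnTime_sub_returnTurns_succ_lt hirr h0 h1 n).trans ih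

theorem returnTime_sub_returnTurns_mul_neg (n : ℕ) :
    (returnTime ρ n * ρ - returnTurns ρ n) *
      (returnTime ρ (n + 1) * ρ - returnTurns ρ (n + 1)) < 0 := by
  have hr := gaussOrbit_mem_Ioo hirr h0 h1 (n + 1)
  rw [returnTime_sub_returnTurns_succ hirr h0 h1]
  have := mul_pos hr.1 (mul_self_pos.2 (returnTime_sub_returnTurns_ne_zero hirr h0 h1 n))
  nlinarith

omit hirr h0 h1 in
theorem det_returnTime_sq (n : ℕ) :
    (returnTime ρ n * returnTurns ρ (n + 1) - returnTime ρ (n + 1) * returnTurns ρ n) ^ 2 = 1 := by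
  induction n with
  | zero => simp [returnTime, returnTurns]
  | succ n ih =>
    rw [← ih, returnTime, returnTurns]
    push_cast
    ring

/-- Write (k, m) = a(q, p) + b(q', p'). The bound on |k| forces a ≠ 0 and ab ≤ 0; as the two errors
have opposite signs, aδ and bδ' do not cancel. -/
theorem abs_returnTime_sub_returnTurns_le {n : ℕ} {k m : ℤ} (hk : k ≠ 0)
    (hkq : |k| < returnTime ρ (n + 1)) :
    |returnTime ρ n * ρ - returnTurns ρ n| ≤ |k * ρ - m| := by
  obtain ⟨hq, hqq⟩ := returnTime_pos_and_le hirr h0 h1 n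
  have hdet := det_returnTime_sq (ρ := ρ) n
  have hneg := returnTime_sub_returnTurns_mul_neg hirr h0 h1 n
  generalize hδ : (returnTime ρ n * ρ - returnTurns ρ n : ℝ) = δ at *
  generalize hδ' : (returnTime ρ (n + 1) * ρ - returnTurns ρ (n + 1) : ℝ) = δ' at *
  generalize returnTime ρ n = q at *
  generalize returnTime ρ (n + 1) = q' at *
  generalize returnTurns ρ n = p at *
  generalize returnTurns ρ (n + 1) = p' at *
  -- Cramer's rule; the determinant has square 1, so multiplying by it is dividing by it.
  obtain ⟨a, ha⟩ : ∃ a : ℤ, a = (q * p' - q' * p) * (k * p' - m * q') := ⟨_, rfl⟩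
  obtain ⟨b, hb⟩ : ∃ b : ℤ, b = (q * p' - q' * p) * (m * q - k * p) := ⟨_, rfl⟩
  have hk' : k = a * q + b * q' := by
    rw [ha, hb]
    linear_combination (-k) * hdet
  have hm' : m = a * p + b * p' := by
    rw [ha, hb]
    linear_combination (-m) * hdet
  have e : k * ρ - m = a * δ + b * δ' := by
    rw [← hδ, ← hδ', hk', hm']
    push_cast
    ring
  have hab : a ≠ 0 ∧ a * b ≤ 0 := by
    rw [abs_lt] at hkq
    have hq0 : (0 : ℤ) < q := by exact_mod_cast hq
    have hq0' : (0 : ℤ) < q' := by exact_mod_cast hq.trans_le hqq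
    constructor
    · rintro rfl
      rw [zero_mul, zero_add] at hk'
      rcases lt_trichotomy b 0 with h | h | h
      · nlinarith
      · rw [h, zero_mul] at hk'; exact hk hk'
      · nlinarith
    · by_contra hn
      rw [not_le] at hn
      rcases pos_and_pos_or_neg_and_neg_of_mul_pos hn with ⟨h, h'⟩ | ⟨h, h'⟩ <;> nlinarith
  have h2 : |δ| ≤ |a * δ| := by
    rw [abs_mul]
    have : (1 : ℝ) ≤ |(a : ℝ)| := by exact_mod_cast Int.one_le_abs hab.1
    exact le_mul_of_one_le_left (abs_nonneg _) this
  refine h2.trans ?_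
  rw [e]
  apply sq_le_sq.1
  have h3 : (0 : ℝ) ≤ (a * b : ℤ) * (δ * δ') :=
    mul_nonneg_of_nonpos_of_nonpos (by exact_mod_cast hab.2) hneg.le
  push_cast at h3
  nlinarith [sq_nonneg (b * δ')]

end

theorem isClosestReturn_returnTime {u : CircleDeg1Liftˣ}
    (hirr : Irrational (u : CircleDeg1Lift).translationNumber) {ρ : ℝ}
    (hρ : ρ = Int.fract (u : CircleDeg1Lift).translationNumber) (n : ℕ) :
    IsClosestReturn u (returnTime ρ n)
      (returnTurns ρ n + returnTime ρ n * ⌊(u : CircleDeg1Lift).translationNumber⌋)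
      (returnTime ρ (n + 1))
      (returnTurns ρ (n + 1) + returnTime ρ (n + 1) *
        ⌊(u : CircleDeg1Lift).translationNumber⌋) := by
  set τ := (u : CircleDeg1Lift).translationNumber with hτ
  have hτρ : τ = ρ + ⌊τ⌋ := by rw [hρ, Int.fract_add_floor]
  have hρi : Irrational ρ := by rw [hρ, ← Int.self_sub_floor]; exact hirr.sub_intCast _
  have h0 : 0 < ρ := lt_of_le_of_ne (hρ ▸ Int.fract_nonneg _) (Ne.symm hρi.ne_zero)
  have h1 : ρ < 1 := hρ ▸ Int.fract_lt_one _
  have e : ∀ n, ((returnTime ρ n : ℤ) : ℝ) * τ - (returnTurns ρ n + returnTime ρ n * ⌊τ⌋ : ℤ) =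
      returnTime ρ n * ρ - returnTurns ρ n := by
    intro n
    nth_rewrite 1 [hτρ]
    push_cast
    ring
  obtain ⟨hq, hqq⟩ := returnTime_pos_and_le hρi h0 h1 n
  refine ⟨hirr, by exact_mod_cast hq, by exact_mod_cast hqq, ?_, ?_, ?_, ?_⟩
  all_goals simp only [← hτ, e]
  · exact abs_returnTime_sub_returnTurns_lt_one hρi h0 h1 n
  · exact returnTime_sub_returnTurns_mul_neg hρi h0 h1 n
  · exact abs_returnTime_sub_returnTurns_succ_lt hρi h0 h1 n
  · intro k m hk hkq
    have := abs_returnTime_sub_returnTurns_le hρi h0 h1 (m := m - k * ⌊τ⌋) hk hkq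
    refine this.trans (le_of_eq ?_)
    congr 1
    nth_rewrite 2 [hτρ]
    push_cast
    ring

/-! ### From the line to the circle -/

theorem coe_eq_coe_iff_exists_add_int {x y : ℝ} :
    (x : UnitAddCircle) = (y : UnitAddCircle) ↔ ∃ m : ℤ, x = y + m := by
  rw [← sub_eq_zero, ← AddCircle.coe_sub, AddCircle.coe_eq_zero_iff]
  simp only [zsmul_eq_mul, mul_one]
  constructor
  · rintro ⟨m, hm⟩
    exact ⟨m, by linarith⟩
  · rintro ⟨m, hm⟩
    exact ⟨m, by linarith⟩

theorem coe_add_int (x : ℝ) (m : ℤ) : ((x + m : ℝ) : UnitAddCircle) = (x : UnitAddCircle) :=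
  coe_eq_coe_iff_exists_add_int.2 ⟨m, rfl⟩

theorem IsLift.strictMono {F : CircleDeg1Lift} {f : UnitAddCircle ≃ₜ UnitAddCircle}
    (hF : IsLift F f) : StrictMono F := by
  rw [CircleDeg1Lift.strictMono_iff_injective]
  intro x y hxy
  have h1 : f (x : UnitAddCircle) = f (y : UnitAddCircle) := by rw [← hF.2, ← hF.2, hxy]
  obtain ⟨m, rfl⟩ := coe_eq_coe_iff_exists_add_int.1 (f.injective h1)
  rw [F.map_add_int] at hxy
  linarith

theorem IsLift.exists_units {F : CircleDeg1Lift} {f : UnitAddCircle ≃ₜ UnitAddCircle}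
    (hF : IsLift F f) : ∃ u : CircleDeg1Liftˣ, (u : CircleDeg1Lift) = F :=
  CircleDeg1Lift.isUnit_iff_bijective.2
    ⟨hF.strictMono.injective, F.continuous_iff_surjective.1 hF.1⟩

theorem IsLift.coe_iterate {F : CircleDeg1Lift} {f : UnitAddCircle → UnitAddCircle}
    (hF : IsLift F f) (n : ℕ) (x : ℝ) : ((F^[n] x : ℝ) : UnitAddCircle) = f^[n] x := by
  induction n with
  | zero => rfl
  | succ n ih => rw [iterate_succ_apply', iterate_succ_apply', hF.2, ih]

theorem IsLift.coe_act {u : CircleDeg1Liftˣ} {f : UnitAddCircle → UnitAddCircle}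
    (hu : IsLift u f) (n : ℕ) (m : ℤ) (x : ℝ) :
    ((act u n m x : ℝ) : UnitAddCircle) = f^[n] x := by
  have : act u n m x = (u : CircleDeg1Lift)^[n] x + (-m : ℤ) := by
    rw [act, zpow_natCast, Units.val_pow_eq_pow_val, CircleDeg1Lift.coe_pow]
    push_cast
    ring
  rw [this, coe_add_int, hu.coe_iterate]

theorem IsLift.irrational {F : CircleDeg1Lift} {f : UnitAddCircle ≃ₜ UnitAddCircle}
    (hF : IsLift F f) (hper : periodicPts f = ∅) : Irrational F.translationNumber := by
  rintro ⟨r, hr⟩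
  have h1 : F.translationNumber = r.num / r.den := by rw [← hr, Rat.cast_def]
  obtain ⟨x, hx⟩ := (F.translationNumber_eq_rat_iff hF.1 r.pos).1 h1
  have h2 : (x : UnitAddCircle) ∈ periodicPts f := by
    refine mk_mem_periodicPts r.pos ?_
    rw [IsPeriodicPt, IsFixedPt, ← hF.coe_iterate, ← CircleDeg1Lift.coe_pow, hx, coe_add_int]
  rw [hper] at h2
  exact h2

theorem IsMulticritical.isMulticriticalLift {f : UnitAddCircle ≃ₜ UnitAddCircle}
    (hf : IsMulticritical f) : IsMulticriticalLift (lift f) := by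
  have hL := isLift_lift hf.orientationPreserving
  refine ⟨hf.contDiff, hL.strictMono, ?_, ?_⟩
  · classical
    refine ⟨hf.finite.toFinset.image fun c => (AddCircle.equivIco (1 : ℝ) 0 c : ℝ), fun x => ?_⟩
    have hcoe : ∀ c : UnitAddCircle, (((AddCircle.equivIco (1 : ℝ) 0 c : ℝ)) : UnitAddCircle) = c :=
      fun c => (AddCircle.equivIco (1 : ℝ) 0).symm_apply_apply c
    simp only [Finset.mem_image, Finite.mem_toFinset, exists_exists_and_eq_and]
    constructor
    · intro hx
      exact ⟨x, ⟨x, rfl, hx⟩, coe_eq_coe_iff_exists_add_int.1 (hcoe x).symm⟩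
    · rintro ⟨c, ⟨y, rfl, hy⟩, hm⟩
      rw [← coe_eq_coe_iff_exists_add_int, hcoe] at hm
      obtain ⟨m, rfl⟩ := coe_eq_coe_iff_exists_add_int.1 hm
      rw [deriv_add_int]
      exact hy
  · intro c hc
    obtain ⟨W, hW, -⟩ := hf.nonflat
    obtain ⟨hWn, hS, α, β, s, hα, hαβ, hs, hpow⟩ := hW c ⟨c, rfl, hc⟩
    have hpre : ((↑) : ℝ → UnitAddCircle) ⁻¹' W c ∈ 𝓝 c :=
      (AddCircle.continuous_mk' (1 : ℝ)).continuousAt hWn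
    obtain ⟨r, hr, hball⟩ := Metric.mem_nhds_iff.1 hpre
    have hne : ∀ x, |x - c| < min r (1 / 2) → x ≠ c → (x : UnitAddCircle) ≠ c := by
      intro x hx hxc h
      obtain ⟨m, rfl⟩ := coe_eq_coe_iff_exists_add_int.1 h
      have h1 := hx.trans_le (min_le_right _ _)
      rw [add_sub_cancel_left] at h1
      have h2 : |m| < 1 := by
        have : |(m : ℝ)| < 1 := by linarith
        exact_mod_cast this
      rw [Int.abs_lt_one_iff.1 h2] at hxc
      simp at hxc
    have hmem : ∀ x, |x - c| < min r (1 / 2) → (x : UnitAddCircle) ∈ W c := fun x hx =>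
      hball (by rw [Metric.mem_ball, Real.dist_eq]; exact hx.trans_le (min_le_left _ _))
    have hnorm : ∀ x, |x - c| < min r (1 / 2) →
        ‖(x : UnitAddCircle) - (c : UnitAddCircle)‖ = |x - c| := by
      intro x hx
      rw [← AddCircle.coe_sub]
      refine (AddCircle.norm_coe_eq_abs_iff (1 : ℝ) one_ne_zero).2 ?_
      rw [abs_one]
      exact (hx.trans_le (min_le_right _ _)).le
    -- Within distance 1/2 the circle norm agrees with the distance on the line and c is the only
    -- lift of its class. At x = c itself the power-law bounds hold as equalities 0 = 0.
    refine ⟨min r (1 / 2), by positivity, fun x hx hxc => hS x (hmem x hx) (hne x hx hxc),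
      α, β, s, hα, hα.trans hαβ, hs, fun x hx => ?_⟩
    by_cases hxc : x = c
    · have h0 : (0 : ℝ) ^ (s - 1) = 0 := Real.zero_rpow (by linarith)
      rw [hxc, hc, sub_self, abs_zero, h0, mul_zero, mul_zero]
      exact ⟨le_rfl, le_rfl⟩
    · have := hpow x (hmem x hx) (hne x hx hxc)
      rw [hnorm x hx] at this
      exact ⟨this.1.le, this.2.le⟩

theorem cIcc_coe_coe {a b : ℝ} (hab : a < b) (hb : b < a + 1) :
    cIcc (a : UnitAddCircle) b = ((↑) : ℝ → UnitAddCircle) '' Icc a b := by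
  have hb' : toIocMod (zero_lt_one (α := ℝ)) a b = b :=
    (toIocMod_eq_self _).2 ⟨hab, hb.le⟩
  ext y
  induction y using QuotientAddGroup.induction_on with | H y => ?_
  have hbtw : (y : UnitAddCircle) ∈ cIcc (a : UnitAddCircle) b ↔
      toIcoMod (zero_lt_one (α := ℝ)) a y ≤ b := by
    nth_rewrite 2 [← hb']
    exact QuotientAddGroup.btw_coe_iff
  have hmod := toIcoMod_mem_Ico (zero_lt_one (α := ℝ)) a y
  refine hbtw.trans ⟨fun h => ⟨toIcoMod (zero_lt_one (α := ℝ)) a y, ⟨hmod.1, h⟩, ?_⟩, ?_⟩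
  · refine coe_eq_coe_iff_exists_add_int.2 ⟨-toIcoDiv (zero_lt_one (α := ℝ)) a y, ?_⟩
    rw [toIcoMod]
    simp [sub_eq_add_neg]
  · rintro ⟨z, hz, hzy⟩
    obtain ⟨m, rfl⟩ := coe_eq_coe_iff_exists_add_int.1 hzy
    have : toIcoMod (zero_lt_one (α := ℝ)) a y = y + m := by
      rw [toIcoMod_eq_iff]
      exact ⟨⟨hz.1, hz.2.trans_lt hb⟩, -m, by simp⟩
    rw [this]
    exact hz.2

theorem length_image_coe_Icc {a b : ℝ} (hab : a ≤ b) (hb : b < a + 1) :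
    length (((↑) : ℝ → UnitAddCircle) '' Icc a b) = b - a := by
  have hmeas : MeasurableSet (((↑) : ℝ → UnitAddCircle) '' Icc a b) :=
    (isCompact_Icc.image (AddCircle.continuous_mk' (1 : ℝ))).isClosed.measurableSet
  have hpre := (UnitAddCircle.measurePreserving_mk (b - 1)).measure_preimage hmeas.nullMeasurableSet
  rw [Measure.restrict_apply (AddCircle.measurable_mk' hmeas)] at hpre
  have hset : ((↑) : ℝ → UnitAddCircle) ⁻¹' (((↑) : ℝ → UnitAddCircle) '' Icc a b) ∩
      Ioc (b - 1) (b - 1 + 1) = Icc a b := by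
    ext s
    constructor
    · rintro ⟨⟨t, ht, hts⟩, hs⟩
      obtain ⟨m, rfl⟩ := coe_eq_coe_iff_exists_add_int.1 hts
      have h1 : (m : ℝ) < 1 := by linarith [ht.2, hs.1]
      have h2 : (-1 : ℝ) < m := by linarith [ht.1, hs.2]
      have h3 : m < 1 := by exact_mod_cast h1
      have h4 : -1 < m := by exact_mod_cast h2
      obtain rfl : m = 0 := by omega
      simpa using ht
    · exact fun hs => ⟨⟨s, hs, rfl⟩, by linarith [hs.1], by linarith [hs.2]⟩
  rw [hset, Real.volume_Icc] at hpre
  rw [length, ← hpre, ENNReal.toReal_ofReal (sub_nonneg.2 hab)]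

theorem image_act_uIcc (u : CircleDeg1Liftˣ) (k m : ℤ) (a b : ℝ) :
    act u k m '' uIcc a b = uIcc (act u k m a) (act u k m b) := by
  have key : ∀ a b, act u k m '' Icc a b = Icc (act u k m a) (act u k m b) := by
    intro a b
    refine Subset.antisymm (image_subset_iff.2 fun x hx =>
      ⟨(act_strictMono u k m).monotone hx.1, (act_strictMono u k m).monotone hx.2⟩) fun y hy => ?_
    rw [← IsReturnPair.act_act_neg u k m y]
    refine mem_image_of_mem _ ⟨?_, ?_⟩
    · rw [← act_le_act_iff' u (k := k) (m := m), IsReturnPair.act_act_neg]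
      exact hy.1
    · rw [← act_le_act_iff' u (k := k) (m := m), IsReturnPair.act_act_neg]
      exact hy.2
  rcases le_total a b with h | h
  · rw [uIcc_of_le h, uIcc_of_le ((act_strictMono u k m).monotone h), key]
  · rw [uIcc_of_ge h, uIcc_of_ge ((act_strictMono u k m).monotone h), key]

section

variable {u : CircleDeg1Liftˣ} {f : UnitAddCircle ≃ₜ UnitAddCircle} {p p' p'' : ℤ}

theorem gap_add_int (u : CircleDeg1Liftˣ) (q p : ℤ) (x : ℝ) (m : ℤ) :
    gap u q p (x + m) = gap u q p x := by
  rw [gap, gap, act_add_int, add_sub_add_right_eq_sub]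

theorem IsClosestReturn.length_image_uIcc {q q' : ℤ} (h : IsClosestReturn u q p q' p') (x : ℝ) :
    length (((↑) : ℝ → UnitAddCircle) '' uIcc x (act u q p x)) = gap u q p x := by
  rcases h.isReturnPair_or with hr | hr
  · rw [hr.uIcc_eq, hr.gap_eq, length_image_coe_Icc (hr.lt_act x).le (hr.act_lt_add_one x)]
  · have h1 := hr.lt_act (-x)
    have h2 := hr.act_lt_add_one (-x)
    simp only [act_reflect, neg_neg] at h1 h2
    rw [uIcc_of_ge (by linarith), length_image_coe_Icc (by linarith) (by linarith), gap,
      abs_sub_comm, abs_of_pos (by linarith)]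

/-- The return of index n + 2 is on the same side as the return of index n and closer, so it selects
the short arc. When that side is the left, the counterclockwise arc from x lifts to [x, Gx + 1] and
misses it. -/
theorem IsClosestReturn.closestReturnArc_eq {n : ℕ} (hu : IsLift u f)
    (h : IsClosestReturn u (q f n) p (q f (n + 1)) p')
    (h' : IsClosestReturn u (q f (n + 1)) p' (q f (n + 2)) p'') (x : ℝ) :
    closestReturnArc f n x =
      ((↑) : ℝ → UnitAddCircle) '' uIcc x (act u (q f n) p x) := by
  set τ := (u : CircleDeg1Lift).translationNumber with hτ
  have a1 := h.mul_neg
  have a2 := h'.mul_neg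
  have a3 := h.abs_lt
  have a4 := h'.abs_lt
  have a5 := h.abs_lt_one
  rw [closestReturnArc, ← hu.coe_act (q f n) p, ← hu.coe_act (q f (n + 2)) p'']
  have hlt : ∀ {k m k' m' : ℤ}, (k : ℝ) * τ - m < k' * τ - m' → act u k m x < act u k' m' x :=
    fun hh => (act_lt_act_iff h.irrational).2 hh
  have hx0 : act u 0 0 x = x := act_zero_zero u x
  have hx1 : act u 0 (-1) x = x + 1 := by rw [act_zero_left]; simp
  rcases lt_or_ge 0 ((q f n : ℤ) * τ - p) with h0 | h0
  · have b1 := neg_of_mul_neg_right a1 h0.le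
    have b2 := pos_of_mul_neg_right a2 b1.le
    rw [abs_of_pos h0, abs_of_neg b1] at a3
    rw [abs_of_neg b1, abs_of_pos b2] at a4
    rw [abs_of_pos h0] at a5
    have c1 : x < act u (q f (n + 2)) p'' x := by
      nth_rewrite 1 [← hx0]
      exact hlt (by rw [Int.cast_zero]; linarith)
    have c2 : act u (q f (n + 2)) p'' x < act u (q f n) p x := hlt (by linarith)
    have c3 : act u (q f n) p x < x + 1 := by
      rw [← hx1]
      exact hlt (by simp only [Int.cast_zero, Int.cast_neg, Int.cast_one]; linarith)
    have c4 := cIcc_coe_coe (c1.trans c2) c3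
    rw [if_pos, c4, uIcc_of_le (c1.trans c2).le]
    rw [c4]
    exact mem_image_of_mem _ ⟨c1.le, c2.le⟩
  · have h0 : (q f n : ℤ) * τ - p < 0 :=
      lt_of_le_of_ne h0 fun h' => by rw [h', zero_mul] at a1; exact a1.false
    have b1 := pos_of_mul_neg_right a1 h0.le
    have b2 := neg_of_mul_neg_right a2 b1.le
    rw [abs_of_neg h0, abs_of_pos b1] at a3
    rw [abs_of_pos b1, abs_of_neg b2] at a4
    rw [abs_of_neg h0] at a5
    have c1 : act u (q f (n + 2)) p'' x < x := by
      nth_rewrite 2 [← hx0]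
      exact hlt (by rw [Int.cast_zero]; linarith)
    have c2 : act u (q f n) p x < act u (q f (n + 2)) p'' x := hlt (by linarith)
    have c3 : x < act u (q f n) p x + 1 := by
      have : act u (q f n) (p - 1) x = act u (q f n) p x + 1 := by
        rw [act_eq_sub, act_eq_sub u _ p]; push_cast; ring
      rw [← this]
      nth_rewrite 1 [← hx0]
      exact hlt (by simp only [Int.cast_zero, Int.cast_sub, Int.cast_one]; linarith)
    have c4 : cIcc (x : UnitAddCircle) (act u (q f n) p x) =
        ((↑) : ℝ → UnitAddCircle) '' Icc x (act u (q f n) p x + 1) := by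
      rw [← cIcc_coe_coe c3 (by linarith)]
      congr 1
      have := coe_add_int (act u (q f n) p x) 1
      rw [Int.cast_one] at this
      exact this.symm
    rw [if_neg, cIcc_coe_coe (c2.trans c1) c3, uIcc_of_ge (c2.trans c1).le]
    rw [c4]
    rintro ⟨s, hs, he⟩
    obtain ⟨m, rfl⟩ := coe_eq_coe_iff_exists_add_int.1 he
    have d1 : (0 : ℝ) < m := by linarith [hs.1]
    have d2 : (m : ℝ) < 1 := by linarith [hs.2]
    have d3 : 0 < m := by exact_mod_cast d1
    have d4 : m < 1 := by exact_mod_cast d2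
    omega

theorem IsClosestReturn.iterate_image_closestReturnArc_eq {n : ℕ} (hu : IsLift u f)
    (h : IsClosestReturn u (q f n) p (q f (n + 1)) p')
    (h' : IsClosestReturn u (q f (n + 1)) p' (q f (n + 2)) p'') (i : ℕ) (x : ℝ) :
    f^[i] '' closestReturnArc f n x = ((↑) : ℝ → UnitAddCircle) ''
      uIcc (act u i 0 x) (act u (q f n) p (act u i 0 x)) := by
  rw [h.closestReturnArc_eq hu h', act_comm, ← image_act_uIcc, image_image, image_image]
  exact image_congr fun y _ => (hu.coe_act i 0 y).symm

theorem exists_mem_uIcc_of_nonempty_inter {q q' : ℤ} {x y : ℝ}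
    (h : ((((↑) : ℝ → UnitAddCircle) '' uIcc x (act u q p x)) ∩
      (((↑) : ℝ → UnitAddCircle) '' uIcc y (act u q' p' y))).Nonempty) :
    ∃ (m : ℤ) (s : ℝ), s ∈ uIcc x (act u q p x) ∧ s ∈ uIcc (y + m) (act u q' p' (y + m)) := by
  obtain ⟨-, ⟨s, hs, rfl⟩, ⟨t, ht, hts⟩⟩ := h
  obtain ⟨m, rfl⟩ := coe_eq_coe_iff_exists_add_int.1 hts.symm
  refine ⟨m, _, hs, ?_⟩
  rw [act_add_int]
  rw [mem_uIcc] at ht ⊢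
  rcases ht with h | h
  · exact Or.inl ⟨by linarith, by linarith⟩
  · exact Or.inr ⟨by linarith, by linarith⟩

end

/-! ### Comparison of atoms -/

theorem exists_length_le (f : UnitAddCircle ≃ₜ UnitAddCircle) (hf : IsMulticritical f)
    (hper : periodicPts f = ∅) :
    ∃ K : ℝ, 1 < K ∧ ∀ n : ℕ, ∀ c ∈ criticalPoints f, ∀ c' ∈ criticalPoints f,
      ∀ Δ ∈ dynamicalPartition f n c, ∀ Δ' ∈ dynamicalPartition f n c', (Δ ∩ Δ').Nonempty →
        length Δ ≤ K * length Δ' := by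
  have hL := isLift_lift hf.orientationPreserving
  obtain ⟨u, hu⟩ := hL.exists_units
  obtain ⟨S, hS, B, Λ, δ, hB, hΛ, hδ, hD⟩ := hf.isMulticriticalLift.exists_hasDistortionBounds
  rw [← hu] at hD hL
  have hirr := hL.irrational hper
  obtain ⟨P, hret⟩ : ∃ P : ℕ → ℤ, ∀ n, IsClosestReturn u (q f n) (P n) (q f (n + 1)) (P (n + 1)) :=
    ⟨_, isClosestReturn_returnTime hirr hL.rotationNumber_eq⟩
  obtain ⟨K, hK, hgap⟩ := hD.exists_gap_le hB hΛ hδ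
  set C := adjacentBound (orbitBound S B Λ δ) with hCdef
  have hC : 1 ≤ C := one_le_adjacentBound (one_le_orbitBound hB hΛ)
  have hrep : ∀ c ∈ criticalPoints f, ∃ s ∈ S, (s : UnitAddCircle) = c := by
    rintro c ⟨x, rfl, hx⟩
    obtain ⟨s, hs, m, rfl⟩ := (hS x).1 hx
    exact ⟨s, hs, (coe_add_int s m).symm⟩
  refine ⟨(1 + 2 * C) * C * K, ?_, ?_⟩
  · have : 1 ≤ C * K := one_le_mul_of_one_le_of_one_le hC hK
    nlinarith
  intro n c hc c' hc' Δ hΔ Δ' hΔ' hne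
  obtain ⟨s, hs, rfl⟩ := hrep c hc
  obtain ⟨s', hs', rfl⟩ := hrep c' hc'
  have h := hret n
  have h' := hret (n + 1)
  have h'' := hret (n + 2)
  have hle : ∀ {a b : ℝ}, 0 ≤ b → a ≤ (1 + 2 * C) * b → a ≤ (1 + 2 * C) * C * K * b := by
    intro a b hb hab
    refine hab.trans (mul_le_mul_of_nonneg_right ?_ hb)
    rw [mul_assoc]
    exact le_mul_of_one_le_right (by positivity) (one_le_mul_of_one_le_of_one_le hC hK)
  have hgl := hD.gap_le hB hΛ hδ h
  have hgl' := hD.gap_le hB hΛ hδ h'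
  have hqle : q f n ≤ q f (n + 1) := by exact_mod_cast h.q_le
  rcases hΔ with ⟨i, hi, rfl⟩ | ⟨i, hi, rfl⟩ <;> rcases hΔ' with ⟨j, hj, rfl⟩ | ⟨j, hj, rfl⟩
  · rw [h.iterate_image_closestReturnArc_eq hL h',
      h.iterate_image_closestReturnArc_eq hL h'] at hne ⊢
    rw [h.length_image_uIcc, h.length_image_uIcc]
    obtain ⟨m, t, ht, ht'⟩ := exists_mem_uIcc_of_nonempty_inter hne
    have := h.gap_le_of_mem_uIcc hgl ht ht'
    rw [gap_add_int] at this
    exact hle (abs_nonneg _) this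
  · rw [h.iterate_image_closestReturnArc_eq hL h',
      h'.iterate_image_closestReturnArc_eq hL h''] at hne ⊢
    rw [h.length_image_uIcc, h'.length_image_uIcc]
    obtain ⟨m, t, ht, ht'⟩ := exists_mem_uIcc_of_nonempty_inter hne
    have h1 := (h.gap_le_gap_of_mem_uIcc hC hgl ht ht').2
    rw [gap_add_int] at h1
    -- Bounding a long atom by a short one is the only case that uses the base point being critical:
    -- the short atom starts at f^j(c') with j < q_n ≤ q_{n+1}.
    have h2 := hgap _ _ _ _ _ _ h h' s' hs' j (by omega) (by
      have := hj.trans_le hqle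
      exact_mod_cast this.le)
    refine h1.trans ?_
    rw [mul_assoc _ K]
    gcongr
  · rw [h'.iterate_image_closestReturnArc_eq hL h'',
      h.iterate_image_closestReturnArc_eq hL h'] at hne ⊢
    rw [h.length_image_uIcc, h'.length_image_uIcc]
    rw [inter_comm] at hne
    obtain ⟨m, t, ht, ht'⟩ := exists_mem_uIcc_of_nonempty_inter hne
    have h1 := (h.gap_le_gap_of_mem_uIcc hC hgl ht ht').1
    rw [gap_add_int] at h1
    exact hle (abs_nonneg _) h1
  · rw [h'.iterate_image_closestReturnArc_eq hL h'',
      h'.iterate_image_closestReturnArc_eq hL h''] at hne ⊢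
    rw [h'.length_image_uIcc, h'.length_image_uIcc]
    obtain ⟨m, t, ht, ht'⟩ := exists_mem_uIcc_of_nonempty_inter hne
    have := h'.gap_le_of_mem_uIcc hgl' ht ht'
    rw [gap_add_int] at this
    exact hle (abs_nonneg _) this

end CircleDynamics

end

theorem mainTheorem6 (f : UnitAddCircle ≃ₜ UnitAddCircle)
    (hf : CircleDynamics.IsMulticritical f)
    (hper : Function.periodicPts f = ∅) :
    ∃ K : ℝ, 1 < K ∧
      ∀ n : ℕ, ∀ c ∈ CircleDynamics.criticalPoints f, ∀ c' ∈ CircleDynamics.criticalPoints f,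
        ∀ Δ ∈ CircleDynamics.dynamicalPartition f n c,
        ∀ Δ' ∈ CircleDynamics.dynamicalPartition f n c',
          (Δ ∩ Δ').Nonempty →
            K⁻¹ * CircleDynamics.length Δ' ≤ CircleDynamics.length Δ ∧
              CircleDynamics.length Δ ≤ K * CircleDynamics.length Δ' := by
  obtain ⟨K, hK, h⟩ := CircleDynamics.exists_length_le f hf hper
  refine ⟨K, hK, fun n c hc c' hc' Δ hΔ Δ' hΔ' hne => ⟨?_, h n c hc c' hc' Δ hΔ Δ' hΔ' hne⟩⟩
  rw [inv_mul_le_iff₀ (by linarith)]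
  exact h n c' hc' c hc Δ' hΔ' Δ hΔ (Set.inter_comm Δ Δ' ▸ hne)
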